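/- Let $M$ be a complex manifold with $\dim_{\mathbb C} M = 2n$ and holomorphic tangent bundle $TM$. A \emph{holomorphic $SL(2)$-web} on $M$ is a family $S_t\subset TM$, $t\in\mathbb{CP}^1$, of holomorphic sub-bundles of rank $n$ such that (i) each $S_t$ is involutive, $[S_t,S_t]\subset S_t$; (ii) $S_t\cap S_{t'}=0$ for $t\neq t'$; (iii) if $P_{t,t'}\in \mathrm{End}(TM)$, $t\ne t'$, denotes the projection onto $S_t$ along $S_{t'}$, then the traceless parts $P_{t,t'}-\tfrac12\mathbf 1$ span a sub-bundle of rank $3$ in $\mathrm{End}(TM)$. A \emph{Chern connection} of the web is a torsion-free holomorphic connection $\nabla$ on $TM$ which preserves $S_t$ for all $t\in\mathbb{CP}^1$. A \emph{trisymplectic structure generating the web} is a $3$-dimensional complex vector space $\boldsymbol\Omega$ of closed holomorphic $2$-forms on $M$ such that for each $t\in\mathbb{CP}^1$ there is $\Omega_t\in\boldsymbol\Omega$ with $S_t=\{v\in TM : \Omega_t(v,\cdot)=0\}$. Theorem. Let $(S_t)_{t\in\mathbb{CP}^1}$ be a holomorphic $SL(2)$-web on $M$, and let $\boldsymbol\Omega$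 be a trisymplectic structure generating it. Then the web has a Chern connection, and every Chern connection $\nabla$ of the web satisfies $\nabla\Omega=0$ for each $\Omega\in\boldsymbol\Omega$. -/

import Mathlib

open Bundle Module
open scoped Manifold ContDiff Topology

noncomputable section

namespace SL2Web

/-! Throughout, `M` is a complex manifold modelled on a finite-dimensional complex vector space `E`,
and `TangentSpace 𝓘(ℂ, E) x` is its holomorphic tangent space at `x`. "Holomorphic" is rendered as
complex analytic, i.e. `C^ω` over `ℂ`. -/

variable {E : Type*} [NormedAddCommGroup E] [NormedSpace ℂ E]
  {M : Type*} [TopologicalSpace M] [ChartedSpace E M]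

/-! ### Vector fields and distributions -/

variable (E M) in
/-- Vector fields on `M`, with no regularity imposed. -/
abbrev VField : Type _ := Π x : M, TangentSpace 𝓘(ℂ, E) x

variable (E M) in
/-- Distributions on `M`: families of complex subspaces of the tangent spaces. -/
abbrev Distribution : Type _ := Π x : M, Submodule ℂ (TangentSpace 𝓘(ℂ, E) x)

/-- The vector field `X` is holomorphic on `U`. -/
def HolomorphicOn [IsManifold 𝓘(ℂ, E) ω M] (X : VField E M) (U : Set M) : Prop :=
  ContMDiffOn 𝓘(ℂ, E) (𝓘(ℂ, E).prod 𝓘(ℂ, E)) ω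
    (fun x ↦ (⟨x, X x⟩ : TotalSpace E (TangentSpace 𝓘(ℂ, E) : M → Type _))) U

/-- `D` is a holomorphic sub-bundle of `TM` of rank `n`: it has a holomorphic frame with `n`
members near each point. -/
def IsHolomorphicSubbundle [IsManifold 𝓘(ℂ, E) ω M] (n : ℕ) (D : Distribution E M) : Prop :=
  ∀ x₀ : M, ∃ U : Set M, IsOpen U ∧ x₀ ∈ U ∧ ∃ s : Fin n → VField E M,
    (∀ i, HolomorphicOn (s i) U) ∧
    ∀ x ∈ U, LinearIndependent ℂ (fun i ↦ s i x) ∧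
      Submodule.span ℂ (Set.range fun i ↦ s i x) = D x

/-- `[D, D] ⊆ D`, for local holomorphic sections of `D`. -/
def IsInvolutive [IsManifold 𝓘(ℂ, E) ω M] (D : Distribution E M) : Prop :=
  ∀ U : Set M, IsOpen U → ∀ X Y : VField E M, HolomorphicOn X U → HolomorphicOn Y U →
    (∀ x ∈ U, X x ∈ D x) → (∀ x ∈ U, Y x ∈ D x) →
    ∀ x ∈ U, VectorField.mlieBracket 𝓘(ℂ, E) X Y x ∈ D x

/-! ### Holomorphic `SL(2)`-webs -/

/-- The complex projective line. -/
abbrev CP1 : Type := Projectivization ℂ (Fin 2 → ℂ)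

/-- For a family `V t` of subspaces of a vector space `T`, the subspace of `End(T)` spanned by the
traceless parts `P - (1/2) • 1` of the projections `P` of `T` onto `V t` along `V t'`, over all pairs
`t ≠ t'` for which `V t` and `V t'` are complementary (in a web these are all pairs `t ≠ t'`, and
each `V t` has dimension `(1/2) dim T`, so that `P` has trace `(1/2) dim T`). -/
def projectionSpan {T : Type*} [AddCommGroup T] [Module ℂ T] (V : CP1 → Submodule ℂ T) :
    Submodule ℂ (T →ₗ[ℂ] T) :=
  Submodule.span ℂ {A | ∃ t t' : CP1, t ≠ t' ∧ ∃ h : IsCompl (V t) (V t'),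
    A = (V t).projection (V t') h - (1 / 2 : ℂ) • LinearMap.id}

/-- A holomorphic `SL(2)`-web on a complex manifold of dimension `2n`: a family of involutive
holomorphic sub-bundles `S t` of `TM` of rank `n`, `t ∈ ℂP¹`, pairwise transversal, such that the
traceless parts of the projections onto `S t` along `S t'` span a sub-bundle of `End(TM)` of
rank 3. -/
structure IsSL2Web [IsManifold 𝓘(ℂ, E) ω M] (n : ℕ) (S : CP1 → Distribution E M) : Prop where
  dim_eq : finrank ℂ E = 2 * n
  subbundle : ∀ t, IsHolomorphicSubbundle n (S t)
  involutive : ∀ t, IsInvolutive (S t)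
  transversal : ∀ t t', t ≠ t' → ∀ x, S t x ⊓ S t' x = ⊥
  rank_projections : ∀ x, finrank ℂ (projectionSpan fun t ↦ S t x) = 3

/-! ### Holomorphic connections -/

/-- A connection on `TM` is holomorphic if it sends holomorphic sections of `TM` over any open set
to holomorphic sections of `Hom(TM, TM)` over that set. -/
def IsHolomorphicConnection [IsManifold 𝓘(ℂ, E) ω M]
    (cov : CovariantDerivative 𝓘(ℂ, E) E (TangentSpace 𝓘(ℂ, E) : M → Type _)) : Prop :=
  ∀ U : Set M, IsOpen U → ContMDiffCovariantDerivativeOn E ω cov.toFun U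

/-- The connection preserves `D`: it maps local holomorphic sections of `D` to `D ⊗ Ω¹M`. -/
def Preserves [IsManifold 𝓘(ℂ, E) ω M]
    (cov : CovariantDerivative 𝓘(ℂ, E) E (TangentSpace 𝓘(ℂ, E) : M → Type _))
    (D : Distribution E M) : Prop :=
  ∀ U : Set M, IsOpen U → ∀ X : VField E M, HolomorphicOn X U → (∀ x ∈ U, X x ∈ D x) →
    ∀ x ∈ U, ∀ v : TangentSpace 𝓘(ℂ, E) x, cov X x v ∈ D x

/-- A Chern connection of the web `S`: a torsion-free holomorphic connection on `TM` preserving all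
the sub-bundles `S t`. -/
structure IsChernConnection [FiniteDimensional ℂ E] [CompleteSpace E] [IsManifold 𝓘(ℂ, E) ω M]
    (S : CP1 → Distribution E M)
    (cov : CovariantDerivative 𝓘(ℂ, E) E (TangentSpace 𝓘(ℂ, E) : M → Type _)) : Prop where
  holomorphic : IsHolomorphicConnection cov
  torsion_free : cov.torsion = 0
  preserves : ∀ t, Preserves cov (S t)

/-! ### Differential 2-forms -/

variable (E M) in
/-- `(2,0)`-forms on `M`: families of complex-bilinear alternating forms on the tangent spaces, with
no regularity imposed. -/
abbrev TwoForm : Type _ := Π x : M, TangentSpace 𝓘(ℂ, E) x [⋀^Fin 2]→L[ℂ] ℂ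

/-- The expression of a 2-form in the preferred chart at `x₀`: its pull-back to (the target of that
chart in) `E` by the inverse of the chart. -/
def TwoForm.inChart (η : TwoForm E M) (x₀ : M) : E → E [⋀^Fin 2]→L[ℂ] ℂ := fun y ↦
  (η ((extChartAt 𝓘(ℂ, E) x₀).symm y)).compContinuousLinearMap
    (mfderiv 𝓘(ℂ, E) 𝓘(ℂ, E) (extChartAt 𝓘(ℂ, E) x₀).symm y)

/-- The 2-form is holomorphic, i.e. it is so in charts. -/
def TwoForm.IsHolomorphic (η : TwoForm E M) : Prop :=
  ∀ x₀ : M, ContDiffOn ℂ ω (TwoForm.inChart η x₀) (extChartAt 𝓘(ℂ, E) x₀).target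

/-- The 2-form is closed: its exterior derivative, computed in charts, vanishes. -/
def TwoForm.IsClosed (η : TwoForm E M) : Prop :=
  ∀ x₀ : M, ∀ y ∈ (extChartAt 𝓘(ℂ, E) x₀).target, extDeriv (TwoForm.inChart η x₀) y = 0

/-- The null-space (annihilator) of a 2-form: all `v` with `η(v, ·) = 0`. -/
def TwoForm.null (η : TwoForm E M) : Distribution E M := fun x ↦
  { carrier := {v | ∀ w : TangentSpace 𝓘(ℂ, E) x, η x ![v, w] = 0}
    add_mem' := by
      intro a b ha hb w
      have h := (η x).toMultilinearMap.cons_add ![w] a b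
      exact h.trans (by
        rw [show (η x).toMultilinearMap (Fin.cons a ![w]) = 0 from ha w,
          show (η x).toMultilinearMap (Fin.cons b ![w]) = 0 from hb w, add_zero])
    zero_mem' := fun w ↦ (η x).map_coord_zero 0 rfl
    smul_mem' := by
      intro c a ha w
      have h := (η x).toMultilinearMap.cons_smul ![w] c a
      exact h.trans (by
        rw [show (η x).toMultilinearMap (Fin.cons a ![w]) = 0 from ha w, smul_zero]) }

/-- `Ω` is a trisymplectic structure generating the web `S`: a 3-dimensional complex vector space of
closed holomorphic 2-forms such that each `S t` is the null-space of a member of `Ω`. -/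
structure GeneratesWeb (Ω : Submodule ℂ (TwoForm E M)) (S : CP1 → Distribution E M) : Prop where
  finrank_eq : finrank ℂ Ω = 3
  holomorphic : ∀ η ∈ Ω, TwoForm.IsHolomorphic η
  closed : ∀ η ∈ Ω, TwoForm.IsClosed η
  generates : ∀ t, ∃ η ∈ Ω, S t = TwoForm.null η

/-- The covariant derivative of a 2-form, evaluated at `x` on a tangent vector `v` and on two vector
fields: `(∇_v η)(Y, Z) = v(η(Y, Z)) - η(∇_v Y, Z) - η(Y, ∇_v Z)`. -/
def covDeriv [IsManifold 𝓘(ℂ, E) ω M]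
    (cov : CovariantDerivative 𝓘(ℂ, E) E (TangentSpace 𝓘(ℂ, E) : M → Type _))
    (η : TwoForm E M) (Y Z : VField E M) (x : M) (v : TangentSpace 𝓘(ℂ, E) x) : ℂ :=
  mvfderiv 𝓘(ℂ, E) (fun y ↦ η y ![Y y, Z y]) x v
    - η x ![cov Y x v, Z x] - η x ![Y x, cov Z x v]

/-- `∇η = 0`. -/
def IsParallel [IsManifold 𝓘(ℂ, E) ω M]
    (cov : CovariantDerivative 𝓘(ℂ, E) E (TangentSpace 𝓘(ℂ, E) : M → Type _))
    (η : TwoForm E M) : Prop :=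
  ∀ U : Set M, IsOpen U → ∀ Y Z : VField E M, HolomorphicOn Y U → HolomorphicOn Z U →
    ∀ x ∈ U, ∀ v : TangentSpace 𝓘(ℂ, E) x, covDeriv cov η Y Z x v = 0

end SL2Web

end

/-!
Choose three members `S_z`, `S_o`, `S_i` of the web, let `P` be the projection onto `S_z` along
`S_i`, `Q = 1 - P`, and let `J` be the involution which fixes `S_o` and exchanges `S_z` and `S_i`.
They identify `TM = S_z ⊕ S_i` with `S_z ⊗ ℂ²`, and the linear relations in the three-dimensional
space `Ω` show that every member but `S_i` is the graph `{u + l • J u | u ∈ S_z}` of a multiple of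
`J`, where `l` is constant on `M`. The involutivity of these graphs is a polynomial condition on
`l`, and it holds for infinitely many `l`. The vanishing of its coefficients says that the
connection `∇_X Y = P([QX, PY] + J[PX, JPY]) + Q([PX, QY] + J[QX, JQY])` is torsion-free, and that
it commutes with `P` and `J` follows from the formula.

Now let `∇` be any Chern connection, and let `η_t ∈ Ω` have the kernel `S_t`. The kernel of each
`∇_u η_t` contains `S_t`. As `η_t` is closed and `∇` is torsion-free, the cyclic sum of
`(∇_u η_t)(v, w)` is zero, so that `∇_u η_t = 0` for `u ∈ S_t`. For `u ∈ S_r`, a relation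
`η_p = a η_r + b η_t + c η_q` thus gives `∇_u η_p = b ∇_u η_t + c ∇_u η_q`, and such a relation
between forms whose kernels contain the pairwise complementary `S_p`, `S_t`, `S_q` forces all three
to vanish.
-/

noncomputable section

namespace SL2Web

section Forms

variable {K T : Type*} [Field K] [AddCommGroup T] [Module K T]
  {B B' B₁ B₂ B₃ : LinearMap.BilinForm K T} {a b c a' b' c' : K}

open LinearMap (ker)

lemma apply_eq_zero_of_mem_ker_right (hB : B.IsRefl) (v : T) {w : T} (hw : w ∈ ker B) :
    B v w = 0 :=
  hB w v (by rw [LinearMap.mem_ker.1 hw, LinearMap.zero_apply])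

lemma mem_ker_of_codisjoint (hB : B.IsRefl) {W : Submodule K T} (hW : Codisjoint (ker B) W) {v : T}
    (hv : ∀ w ∈ W, B v w = 0) : v ∈ ker B := by
  refine LinearMap.mem_ker.2 (LinearMap.ext fun y ↦ ?_)
  obtain ⟨k, hk, w, hw, rfl⟩ := Submodule.mem_sup.1 (hW.eq_top ▸ Submodule.mem_top : y ∈ _)
  rw [map_add, apply_eq_zero_of_mem_ker_right hB v hk, hv w hw, add_zero, LinearMap.zero_apply]

lemma coeff_eq_zero_of_ker (h₁ : B₁.IsRefl) (h₃ : B₃.IsRefl) (h₂ : ker B₂ ≠ ⊥)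
    (h₁₂ : Disjoint (ker B₁) (ker B₂)) (h₁₃ : Codisjoint (ker B₁) (ker B₃))
    (h : a • B₁ + b • B₂ + c • B₃ = 0) : a = 0 := by
  obtain ⟨s, hs, hs0⟩ := Submodule.exists_mem_ne_zero_of_ne_bot h₂
  by_contra ha
  refine hs0 (Submodule.disjoint_def.1 h₁₂ s (mem_ker_of_codisjoint h₁ h₁₃ fun w hw ↦ ?_) hs)
  simpa [LinearMap.mem_ker.1 hs, apply_eq_zero_of_mem_ker_right h₃ s hw, ha] using
    LinearMap.congr_fun₂ h s w

lemma add_mem_ker_iff (hB : B.IsRefl) (h₂ : B₂.IsRefl) (hB₂ : Codisjoint (ker B) (ker B₂))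
    (h : B = a • B₁ + b • B₂ + c • B₃) {u v : T} (hu : u ∈ ker B₁) (hv : v ∈ ker B₃) :
    u + v ∈ ker B ↔ ∀ w ∈ ker B₂, a * B₁ v w + c * B₃ u w = 0 := by
  have hB_apply {w : T} (hw : w ∈ ker B₂) : B (u + v) w = a * B₁ v w + c * B₃ u w := by
    have h₁w : B₁ (u + v) w = B₁ v w := by rw [map_add, LinearMap.mem_ker.1 hu, zero_add]
    have h₃w : B₃ (u + v) w = B₃ u w := by rw [map_add, LinearMap.mem_ker.1 hv, add_zero]
    simp only [h, LinearMap.add_apply, LinearMap.smul_apply, smul_eq_mul, h₁w, h₃w,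
      apply_eq_zero_of_mem_ker_right h₂ (u + v) hw, mul_zero, add_zero]
  refine ⟨fun huv w hw ↦ ?_, fun huv ↦ mem_ker_of_codisjoint hB hB₂ fun w hw ↦ ?_⟩
  · rw [← hB_apply hw, LinearMap.mem_ker.1 huv, LinearMap.zero_apply]
  · rw [hB_apply hw, huv w hw]

lemma add_smul_mem_ker (hB : B.IsRefl) (hB' : B'.IsRefl) (h₂ : B₂.IsRefl)
    (hB₂ : Codisjoint (ker B) (ker B₂)) (hB₂' : Codisjoint (ker B') (ker B₂))
    (h : B = a • B₁ + b • B₂ + c • B₃) (h' : B' = a' • B₁ + b' • B₂ + c' • B₃)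
    (ha : a ≠ 0) (hc' : c' ≠ 0) {u v : T} (hu : u ∈ ker B₁) (hv : v ∈ ker B₃)
    (huv : u + v ∈ ker B') : u + (c * a' / (a * c')) • v ∈ ker B := by
  rw [add_mem_ker_iff hB' h₂ hB₂' h' hu hv] at huv
  refine (add_mem_ker_iff hB h₂ hB₂ h hu (Submodule.smul_mem _ _ hv)).2 fun w hw ↦ ?_
  rw [map_smul, LinearMap.smul_apply, smul_eq_mul]
  field_simp
  linear_combination c * huv w hw

lemma eq_zero_of_eq_smul_add_smul (h₂ : B₂.IsRefl) (h₃ : B₃.IsRefl)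
    (h₁₂ : Codisjoint (ker B₁) (ker B₂)) (h₂₃ : Codisjoint (ker B₂) (ker B₃))
    (h : B₁ = b • B₂ + c • B₃) (hb : b ≠ 0) : B₂ = 0 := by
  have h₁ : ker B₁ ≤ ker B₂ := fun v hv ↦ mem_ker_of_codisjoint h₂ h₂₃ fun w hw ↦ by
    simpa [LinearMap.mem_ker.1 hv, apply_eq_zero_of_mem_ker_right h₃ v hw, hb] using
      LinearMap.congr_fun₂ h v w
  rw [← LinearMap.ker_eq_top, ← h₁₂.eq_top, sup_eq_right.2 h₁]

end Forms

lemma apply_swap {K T : Type*} [NormedField K] [AddCommGroup T] [Module K T] [TopologicalSpace T]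
    (f : T [⋀^Fin 2]→L[K] K) (v w : T) : f ![v, w] = -f ![w, v] := by
  have h := f.toAlternatingMap.map_swap ![w, v] (i := 0) (j := 1) (by decide)
  rwa [show ![w, v] ∘ Equiv.swap (0 : Fin 2) 1 = ![v, w] by ext i; fin_cases i <;> rfl] at h

section Web

variable {E : Type*} [NormedAddCommGroup E] [NormedSpace ℂ E]
  {M : Type*} [TopologicalSpace M] [ChartedSpace E M]

namespace TwoForm

variable (η : TwoForm E M) (x : M)

lemma swap (v w : TangentSpace 𝓘(ℂ, E) x) : η x ![v, w] = -η x ![w, v] := apply_swap (η x) v w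

lemma apply_add_left (u v w : TangentSpace 𝓘(ℂ, E) x) :
    η x ![u + v, w] = η x ![u, w] + η x ![v, w] :=
  (η x).toMultilinearMap.cons_add ![w] u v

lemma apply_smul_left (c : ℂ) (v w : TangentSpace 𝓘(ℂ, E) x) :
    η x ![c • v, w] = c * η x ![v, w] :=
  (η x).toMultilinearMap.cons_smul ![w] c v

lemma apply_add_right (u v w : TangentSpace 𝓘(ℂ, E) x) :
    η x ![u, v + w] = η x ![u, v] + η x ![u, w] := by
  rw [swap, apply_add_left, swap η x u v, swap η x u w, neg_add]

lemma apply_smul_right (c : ℂ) (v w : TangentSpace 𝓘(ℂ, E) x) :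
    η x ![v, c • w] = c * η x ![v, w] := by
  rw [swap, apply_smul_left, swap η x v w, mul_neg]

/-- The bilinear form on the tangent space at `x` given by a 2-form, as a linear function of the
2-form. -/
def bilin : TwoForm E M →ₗ[ℂ] LinearMap.BilinForm ℂ (TangentSpace 𝓘(ℂ, E) x) where
  toFun η := LinearMap.mk₂ ℂ (fun v w ↦ η x ![v, w]) (apply_add_left η x) (apply_smul_left η x)
    (apply_add_right η x) (apply_smul_right η x)
  map_add' _ _ := rfl
  map_smul' _ _ := rfl

lemma isRefl_bilin : (bilin x η).IsRefl := fun v w h ↦ by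
  change η x ![w, v] = 0
  rw [swap, show η x ![v, w] = 0 from h, neg_zero]

lemma ker_bilin : LinearMap.ker (bilin x η) = η.null x :=
  Submodule.ext fun _ ↦ LinearMap.ext_iff

end TwoForm

namespace GeneratesWeb

variable {S : CP1 → Distribution E M} {Ω : Submodule ℂ (TwoForm E M)}

lemma nonempty (hΩ : GeneratesWeb Ω S) : Nonempty M := by
  by_contra! hM
  have : Subsingleton Ω := ⟨fun a b ↦ Subtype.ext (funext fun x ↦ hM.elim x)⟩
  have h := hΩ.finrank_eq
  rw [finrank_zero_of_subsingleton] at h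
  omega

/-- A chosen member of `Ω` with null-space `S t`, the `Ω_t` of the paper. -/
def form (hΩ : GeneratesWeb Ω S) (t : CP1) : TwoForm E M := (hΩ.generates t).choose

lemma form_mem (hΩ : GeneratesWeb Ω S) (t : CP1) : hΩ.form t ∈ Ω := (hΩ.generates t).choose_spec.1

lemma null_form (hΩ : GeneratesWeb Ω S) (t : CP1) : (hΩ.form t).null = S t :=
  (hΩ.generates t).choose_spec.2.symm

lemma isHolomorphic_form (hΩ : GeneratesWeb Ω S) (t : CP1) : (hΩ.form t).IsHolomorphic :=
  hΩ.holomorphic _ (hΩ.form_mem t)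

lemma ker_bilin_form (hΩ : GeneratesWeb Ω S) (t : CP1) (x : M) :
    LinearMap.ker ((hΩ.form t).bilin x) = S t x := by
  rw [TwoForm.ker_bilin, hΩ.null_form]

end GeneratesWeb

variable [IsManifold 𝓘(ℂ, E) ω M] {n : ℕ} {S : CP1 → Distribution E M}
  {Ω : Submodule ℂ (TwoForm E M)}

lemma IsHolomorphicSubbundle.finrank_eq {D : Distribution E M}
    (hD : IsHolomorphicSubbundle n D) (x : M) : finrank ℂ (D x) = n := by
  obtain ⟨U, -, hxU, s, -, hs⟩ := hD x
  rw [← (hs x hxU).2, finrank_span_eq_card (hs x hxU).1, Fintype.card_fin]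

lemma IsSL2Web.finrank_tangentSpace (hS : IsSL2Web n S) (x : M) :
    finrank ℂ (TangentSpace 𝓘(ℂ, E) x) = 2 * n := hS.dim_eq

section FiniteDimensional

instance (x : M) [FiniteDimensional ℂ E] : FiniteDimensional ℂ (TangentSpace 𝓘(ℂ, E) x) :=
  inferInstanceAs (FiniteDimensional ℂ E)

variable [FiniteDimensional ℂ E]

lemma IsSL2Web.isCompl (hS : IsSL2Web n S) {t t' : CP1} (h : t ≠ t') (x : M) :
    IsCompl (S t x) (S t' x) := by
  have hd : Disjoint (S t x) (S t' x) := disjoint_iff.2 (hS.transversal t t' h x)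
  refine ⟨hd, codisjoint_iff.2 (Submodule.eq_top_of_disjoint _ _ ?_ hd)⟩
  rw [(hS.subbundle t).finrank_eq, (hS.subbundle t').finrank_eq, hS.finrank_tangentSpace, two_mul]

lemma IsSL2Web.ne_bot (hS : IsSL2Web n S) (t : CP1) (x : M) : S t x ≠ ⊥ := by
  intro h
  have hn : n = 0 := by rw [← (hS.subbundle t).finrank_eq x, h, finrank_bot]
  have hle := Submodule.finrank_le (projectionSpan fun t ↦ S t x)
  rw [hS.rank_projections x, finrank_linearMap, hS.finrank_tangentSpace, hn] at hle
  omega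

namespace GeneratesWeb

variable {p q r t : CP1} {a b c : ℂ}

lemma coeff_eq_zero (hΩ : GeneratesWeb Ω S) (hS : IsSL2Web n S) (hpq : p ≠ q) (hpr : p ≠ r)
    (h : a • hΩ.form p + b • hΩ.form q + c • hΩ.form r = 0) : a = 0 := by
  obtain ⟨x⟩ := hΩ.nonempty
  have hx := congrArg (TwoForm.bilin x) h
  simp only [map_add, map_smul, map_zero] at hx
  refine coeff_eq_zero_of_ker (TwoForm.isRefl_bilin _ x) (TwoForm.isRefl_bilin _ x) ?_ ?_ ?_ hx
  all_goals simp only [ker_bilin_form]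
  exacts [hS.ne_bot q x, (hS.isCompl hpq x).disjoint, (hS.isCompl hpr x).codisjoint]

lemma coeff_ne_zero (hΩ : GeneratesWeb Ω S) (hS : IsSL2Web n S) (htq : t ≠ q) (htr : t ≠ r)
    (h : hΩ.form t = a • hΩ.form p + b • hΩ.form q + c • hΩ.form r) : a ≠ 0 := by
  rintro rfl
  refine one_ne_zero (hΩ.coeff_eq_zero hS htq htr (a := 1) (b := -b) (c := -c) ?_)
  rw [h]
  module

lemma linearIndependent_form (hΩ : GeneratesWeb Ω S) (hS : IsSL2Web n S) (hpq : p ≠ q)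
    (hpr : p ≠ r) (hqr : q ≠ r) :
    LinearIndependent ℂ ![hΩ.form p, hΩ.form q, hΩ.form r] := by
  refine Fintype.linearIndependent_iff.2 fun g hg ↦ Fin.forall_fin_succ.2 ?_
  replace hg : g 0 • hΩ.form p + g 1 • hΩ.form q + g 2 • hΩ.form r = 0 := by
    rw [← hg, Fin.sum_univ_three]; rfl
  refine ⟨hΩ.coeff_eq_zero hS hpq hpr hg, Fin.forall_fin_two.2 ⟨?_, ?_⟩⟩
  · exact hΩ.coeff_eq_zero hS hpq.symm hqr
      ((by abel : g 1 • hΩ.form q + g 0 • hΩ.form p + g 2 • hΩ.form r = _).trans hg)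
  · exact hΩ.coeff_eq_zero hS hpr.symm hqr.symm
      ((by abel : g 2 • hΩ.form r + g 0 • hΩ.form p + g 1 • hΩ.form q = _).trans hg)

lemma exists_eq_smul_form (hΩ : GeneratesWeb Ω S) (hS : IsSL2Web n S) (hpq : p ≠ q) (hpr : p ≠ r)
    (hqr : q ≠ r) {η : TwoForm E M} (hη : η ∈ Ω) :
    ∃ a b c : ℂ, η = a • hΩ.form p + b • hΩ.form q + c • hΩ.form r := by
  have : FiniteDimensional ℂ Ω := FiniteDimensional.of_finrank_pos (by simp [hΩ.finrank_eq])
  let f : Fin 3 → TwoForm E M := ![hΩ.form p, hΩ.form q, hΩ.form r]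
  have hspan : Submodule.span ℂ (Set.range f) = Ω := by
    refine Submodule.eq_of_le_of_finrank_eq (Submodule.span_le.2 ?_) ?_
    · rintro _ ⟨j, rfl⟩
      fin_cases j
      exacts [hΩ.form_mem p, hΩ.form_mem q, hΩ.form_mem r]
    · rw [finrank_span_eq_card (hΩ.linearIndependent_form hS hpq hpr hqr), hΩ.finrank_eq,
        Fintype.card_fin]
  obtain ⟨g, rfl⟩ := (Submodule.mem_span_range_iff_exists_fun ℂ).1 (hspan.symm ▸ hη)
  exact ⟨g 0, g 1, g 2, Fin.sum_univ_three _⟩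

end GeneratesWeb

instance : Infinite CP1 := by
  refine Infinite.of_injective
    (fun c : ℂ ↦ Projectivization.mk ℂ ![1, c] fun h ↦ one_ne_zero (congrFun h 0)) fun a b h ↦ ?_
  obtain ⟨u, hu⟩ := (Projectivization.mk_eq_mk_iff' ℂ _ _ _ _).1 h
  have h0 : u = 1 := by simpa using congrFun hu 0
  simpa [h0] using (congrFun hu 1).symm

/-- In the decomposition `TM = S z ⊕ S i` the constant `l` does not depend on the point, since it is
computed from the coefficients of linear relations in `Ω`. -/
lemma GeneratesWeb.exists_add_smul_mem (hΩ : GeneratesWeb Ω S) (hS : IsSL2Web n S) {z i o t : CP1}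
    (hzi : z ≠ i) (hoz : o ≠ z) (hti : t ≠ i) :
    ∃ l : ℂ, ∀ x, ∀ u ∈ S z x, ∀ v ∈ S i x, u + v ∈ S o x → u + l • v ∈ S t x := by
  obtain ⟨r, hr⟩ := (Set.toFinite {z, i, o, t}).exists_notMem
  simp only [Set.mem_insert_iff, Set.mem_singleton_iff, not_or] at hr
  obtain ⟨hrz, hri, hro, hrt⟩ := hr
  obtain ⟨a, b, c, h⟩ := hΩ.exists_eq_smul_form hS (Ne.symm hrz) hzi hri (hΩ.form_mem t)
  obtain ⟨a', b', c', h'⟩ := hΩ.exists_eq_smul_form hS (Ne.symm hrz) hzi hri (hΩ.form_mem o)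
  have ha : a ≠ 0 := hΩ.coeff_ne_zero hS (Ne.symm hrt) hti h
  have hc' : c' ≠ 0 := hΩ.coeff_ne_zero hS (Ne.symm hro) hoz
    (h'.trans (by abel : _ = c' • hΩ.form i + b' • hΩ.form r + a' • hΩ.form z))
  refine ⟨c * a' / (a * c'), fun x u hu v hv huv ↦ ?_⟩
  have hx := congrArg (TwoForm.bilin x) h
  have hx' := congrArg (TwoForm.bilin x) h'
  have hrefl (p : CP1) := TwoForm.isRefl_bilin (hΩ.form p) x
  have hcod {p : CP1} (hp : p ≠ r) := (hS.isCompl hp x).codisjoint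
  simp only [map_add, map_smul] at hx hx'
  simp only [← hΩ.ker_bilin_form] at hu hv huv hcod ⊢
  exact add_smul_mem_ker (hrefl t) (hrefl o) (hrefl r) (hcod (Ne.symm hrt)) (hcod (Ne.symm hro))
    hx hx' ha hc' hu hv huv

end FiniteDimensional

end Web

section Endomorphisms

variable {E : Type*} [NormedAddCommGroup E] [NormedSpace ℂ E]
  {M : Type*} [TopologicalSpace M] [ChartedSpace E M]

variable (E M) in
/-- Fields of endomorphisms of the tangent spaces, with no regularity imposed. -/
abbrev EndField : Type _ := Π x : M, TangentSpace 𝓘(ℂ, E) x →L[ℂ] TangentSpace 𝓘(ℂ, E) x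

/-- The action of fields of endomorphisms on vector fields. -/
def EndField.app (A : EndField E M) (X : VField E M) : VField E M := fun x ↦ A x (X x)

variable [IsManifold 𝓘(ℂ, E) ω M]

/-- The vector field `X` is holomorphic near `x`. -/
abbrev HolomorphicAt (X : VField E M) (x : M) : Prop :=
  ContMDiffAt 𝓘(ℂ, E) (𝓘(ℂ, E).prod 𝓘(ℂ, E)) ω
    (fun x ↦ (⟨x, X x⟩ : TotalSpace E (TangentSpace 𝓘(ℂ, E) : M → Type _))) x

/-- The vector field `X` is complex differentiable at `x`. -/
abbrev DiffAt (X : VField E M) (x : M) : Prop :=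
  MDifferentiableAt 𝓘(ℂ, E) (𝓘(ℂ, E).prod 𝓘(ℂ, E))
    (fun x ↦ (⟨x, X x⟩ : TotalSpace E (TangentSpace 𝓘(ℂ, E) : M → Type _))) x

/-- The field of endomorphisms `A` is holomorphic near `x`. -/
abbrev EndHolomorphicAt (A : EndField E M) (x : M) : Prop :=
  ContMDiffAt 𝓘(ℂ, E) (𝓘(ℂ, E).prod 𝓘(ℂ, E →L[ℂ] E)) ω
    (fun x ↦ (⟨x, A x⟩ : TotalSpace (E →L[ℂ] E)
      fun x : M ↦ TangentSpace 𝓘(ℂ, E) x →L[ℂ] TangentSpace 𝓘(ℂ, E) x)) x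

variable {A : EndField E M} {X Y : VField E M} {x : M}

lemma HolomorphicAt.diffAt (h : HolomorphicAt X x) : DiffAt X x :=
  h.mdifferentiableAt (by simp)

lemma HolomorphicOn.holomorphicAt {U : Set M} (h : HolomorphicOn X U) (hU : IsOpen U)
    (hx : x ∈ U) : HolomorphicAt X x :=
  ContMDiffOn.contMDiffAt h (hU.mem_nhds hx)

lemma HolomorphicAt.exists_holomorphicOn (h : HolomorphicAt X x) :
    ∃ U, IsOpen U ∧ x ∈ U ∧ HolomorphicOn X U := by
  have h_nhds := (contMDiffAt_iff_contMDiffAt_nhds (by simp)).1 h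
  obtain ⟨U, hU, hUo, hxU⟩ := eventually_nhds_iff.1 h_nhds
  exact ⟨U, hUo, hxU, fun y hy ↦ (hU y hy).contMDiffWithinAt⟩

lemma EndHolomorphicAt.app (hA : EndHolomorphicAt A x) (hX : HolomorphicAt X x) :
    HolomorphicAt (A.app X) x :=
  ContMDiffAt.clm_bundle_apply hA hX

lemma EndHolomorphicAt.diffAt_app (hA : EndHolomorphicAt A x) (hX : DiffAt X x) :
    DiffAt (A.app X) x :=
  MDifferentiableAt.clm_bundle_apply (hA.mdifferentiableAt (by simp)) hX

lemma HolomorphicAt.mlieBracket [CompleteSpace E] (hX : HolomorphicAt X x)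
    (hY : HolomorphicAt Y x) : HolomorphicAt (VectorField.mlieBracket 𝓘(ℂ, E) X Y) x := by
  have : IsManifold 𝓘(ℂ, E) (ω + 1) M := inferInstanceAs (IsManifold 𝓘(ℂ, E) ω M)
  rw [HolomorphicAt, ← contMDiffWithinAt_univ] at *
  rw [← VectorField.mlieBracketWithin_univ]
  exact hX.mlieBracketWithin_vectorField (n := ω) hY uniqueMDiffOn_univ (Set.mem_univ _) (by simp)

section Frames

variable {ι : Type*} [Fintype ι]

/-- The linear map `c ↦ ∑ i, c i • X i x`, read in the preferred trivialization of the tangent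
bundle at `x₀`; it is a junk value for `x` outside the base set of this trivialization. -/
def frameMap (X : ι → VField E M) (x₀ x : M) : (ι → ℂ) →L[ℂ] E :=
  ∑ i, ContinuousLinearMap.smulRightL ℂ (ι → ℂ) E (ContinuousLinearMap.proj i)
    (trivializationAt E (TangentSpace 𝓘(ℂ, E) : M → Type _) x₀ ⟨x, X i x⟩).2

lemma frameMap_apply (X : ι → VField E M) {x₀ x : M}
    (hx : x ∈ (trivializationAt E (TangentSpace 𝓘(ℂ, E) : M → Type _) x₀).baseSet) (c : ι → ℂ) :
    frameMap X x₀ x c = (trivializationAt E (TangentSpace 𝓘(ℂ, E) : M → Type _)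
      x₀).continuousLinearMapAt ℂ x (∑ i, c i • X i x) := by
  simp only [frameMap, map_sum, map_smul, sum_apply]
  refine Finset.sum_congr rfl fun i _ ↦ ?_
  rw [Trivialization.continuousLinearMapAt_apply, Trivialization.coe_linearMapAt_of_mem _ hx]
  rfl

lemma contMDiffAt_frameMap {X : ι → VField E M} {x₀ : M} (hX : ∀ i, HolomorphicAt (X i) x₀) :
    ContMDiffAt 𝓘(ℂ, E) 𝓘(ℂ, (ι → ℂ) →L[ℂ] E) ω (frameMap X x₀) x₀ :=
  ContMDiffAt.sum fun i _ ↦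
    (ContinuousLinearMap.smulRightL ℂ (ι → ℂ) E
      (ContinuousLinearMap.proj i)).contMDiff.contMDiffAt.comp x₀ ((contMDiffAt_section _).1 (hX i))

lemma inCoordinates_comp_frameMap (A : EndField E M) (e : ι → VField E M) {x₀ x : M}
    (hx : x ∈ (trivializationAt E (TangentSpace 𝓘(ℂ, E) : M → Type _) x₀).baseSet) :
    (ContinuousLinearMap.inCoordinates E (TangentSpace 𝓘(ℂ, E)) E (TangentSpace 𝓘(ℂ, E))
      x₀ x x₀ x (A x)).comp (frameMap e x₀ x) = frameMap (fun i ↦ A.app (e i)) x₀ x := by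
  ext1 c
  rw [ContinuousLinearMap.comp_apply, frameMap_apply e hx, frameMap_apply _ hx,
    ContinuousLinearMap.inCoordinates, ContinuousLinearMap.comp_apply,
    ContinuousLinearMap.comp_apply, Trivialization.symmL_continuousLinearMapAt _ hx]
  simp only [map_sum, map_smul, EndField.app]

variable [FiniteDimensional ℂ E]

lemma exists_equiv_eq_frameMap (hι : Fintype.card ι = finrank ℂ E) {e : ι → VField E M} {x₀ x : M}
    (hx : x ∈ (trivializationAt E (TangentSpace 𝓘(ℂ, E) : M → Type _) x₀).baseSet)
    (he : LinearIndependent ℂ fun i ↦ e i x) :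
    ∃ g : (ι → ℂ) ≃L[ℂ] E, (g : (ι → ℂ) →L[ℂ] E) = frameMap e x₀ x := by
  set τ := trivializationAt E (TangentSpace 𝓘(ℂ, E) : M → Type _) x₀
  have hinj : Function.Injective (frameMap e x₀ x : (ι → ℂ) →ₗ[ℂ] E) := by
    refine LinearMap.ker_eq_bot.1 (LinearMap.ker_eq_bot'.2 fun c hc ↦ ?_)
    have hc' : τ.continuousLinearMapAt ℂ x (∑ i, c i • e i x) = 0 := frameMap_apply e hx c ▸ hc
    refine funext (Fintype.linearIndependent_iff.1 he c ?_)
    rw [← τ.symmL_continuousLinearMapAt (R := ℂ) hx (∑ i, c i • e i x), hc', map_zero]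
  exact ⟨(LinearEquiv.ofInjectiveOfFinrankEq _ hinj (by simpa using hι)).toContinuousLinearEquiv,
    ContinuousLinearMap.ext fun _ ↦ rfl⟩

lemma endHolomorphicAt_of_frame (hι : Fintype.card ι = finrank ℂ E) {e : ι → VField E M} {x₀ : M}
    (he : ∀ i, HolomorphicAt (e i) x₀) (hli : ∀ᶠ x in 𝓝 x₀, LinearIndependent ℂ fun i ↦ e i x)
    (hAe : ∀ i, HolomorphicAt (A.app (e i)) x₀) : EndHolomorphicAt A x₀ := by
  have : CompleteSpace E := FiniteDimensional.complete ℂ E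
  have hbase : ∀ᶠ x in 𝓝 x₀,
      x ∈ (trivializationAt E (TangentSpace 𝓘(ℂ, E) : M → Type _) x₀).baseSet :=
    (trivializationAt E (TangentSpace 𝓘(ℂ, E) : M → Type _) x₀).open_baseSet.mem_nhds
      (FiberBundle.mem_baseSet_trivializationAt' x₀)
  have hinverse : ContMDiffAt 𝓘(ℂ, E) 𝓘(ℂ, E →L[ℂ] (ι → ℂ)) ω
      (fun x ↦ (frameMap e x₀ x).inverse) x₀ := by
    obtain ⟨g, hg⟩ := exists_equiv_eq_frameMap hι hbase.self_of_nhds hli.self_of_nhds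
    exact (hg ▸ contDiffAt_map_inverse g).contMDiffAt.comp x₀ (contMDiffAt_frameMap he)
  refine (contMDiffAt_hom_bundle _).2 ⟨contMDiffAt_id, ?_⟩
  refine ((contMDiffAt_frameMap hAe).clm_comp hinverse).congr_of_eventuallyEq ?_
  filter_upwards [hbase, hli] with x hx hlix
  obtain ⟨g, hg⟩ := exists_equiv_eq_frameMap hι hx hlix
  rw [← inCoordinates_comp_frameMap A e hx, ContinuousLinearMap.comp_assoc, ← hg,
    ContinuousLinearMap.inverse_equiv, ContinuousLinearEquiv.coe_comp_coe_symm,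
    ContinuousLinearMap.comp_id]

lemma endHolomorphicAt_of_forall (hA : ∀ X, HolomorphicAt X x → HolomorphicAt (A.app X) x) :
    EndHolomorphicAt A x := by
  let b := finBasis ℂ E
  let τ := trivializationAt E (TangentSpace 𝓘(ℂ, E) : M → Type _) x
  have he i : HolomorphicAt (τ.localFrame b i) x :=
    contMDiffAt_localFrame_of_mem ω τ b i (FiberBundle.mem_baseSet_trivializationAt' x)
  refine endHolomorphicAt_of_frame (Fintype.card_fin _) he ?_ fun i ↦ hA _ (he i)
  exact Filter.eventually_of_mem
    (τ.open_baseSet.mem_nhds (FiberBundle.mem_baseSet_trivializationAt' x))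
    fun y hy ↦ (τ.isLocalFrameOn_localFrame_baseSet 𝓘(ℂ, E) 1 b).linearIndependent hy

end Frames

end Endomorphisms

section Splittings

variable {E : Type*} [NormedAddCommGroup E] [NormedSpace ℂ E]
  {M : Type*} [TopologicalSpace M] [ChartedSpace E M]

namespace EndField

variable (A B : EndField E M)

lemma app_add (X Y : VField E M) : A.app (X + Y) = A.app X + A.app Y :=
  funext fun x ↦ map_add (A x) _ _

lemma app_smul (f : M → ℂ) (X : VField E M) : A.app (f • X) = f • A.app X :=
  funext fun x ↦ map_smul (A x) _ _

lemma app_zero : A.app 0 = 0 := funext fun x ↦ map_zero (A x)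

/-- The distribution of kernels of a field of endomorphisms. -/
def ker : Distribution E M := fun x ↦ LinearMap.ker (A x).toLinearMap

variable {A} in
lemma mem_ker {x : M} {v : TangentSpace 𝓘(ℂ, E) x} : v ∈ A.ker x ↔ A x v = 0 := Iff.rfl

end EndField

section Holomorphic

variable [IsManifold 𝓘(ℂ, E) ω M] [FiniteDimensional ℂ E] {A B : EndField E M} {x : M}

lemma EndHolomorphicAt.one : EndHolomorphicAt (1 : EndField E M) x :=
  endHolomorphicAt_of_forall fun _ hX ↦ hX

lemma EndHolomorphicAt.add (hA : EndHolomorphicAt A x) (hB : EndHolomorphicAt B x) :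
    EndHolomorphicAt (A + B) x :=
  endHolomorphicAt_of_forall fun _ hX ↦ (hA.app hX).add_section (hB.app hX)

lemma EndHolomorphicAt.sub (hA : EndHolomorphicAt A x) (hB : EndHolomorphicAt B x) :
    EndHolomorphicAt (A - B) x :=
  endHolomorphicAt_of_forall fun _ hX ↦ (hA.app hX).sub_section (hB.app hX)

lemma EndHolomorphicAt.mul (hA : EndHolomorphicAt A x) (hB : EndHolomorphicAt B x) :
    EndHolomorphicAt (A * B) x :=
  endHolomorphicAt_of_forall fun _ hX ↦ hA.app (hB.app hX)

lemma EndHolomorphicAt.const_smul (c : ℂ) (hA : EndHolomorphicAt A x) :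
    EndHolomorphicAt (c • A) x :=
  endHolomorphicAt_of_forall fun _ hX ↦ (contMDiffAt_const (c := c)).smul_section (hA.app hX)

end Holomorphic

section Projections

instance (x : M) [T2Space E] : T2Space (TangentSpace 𝓘(ℂ, E) x) :=
  inferInstanceAs (T2Space E)

variable [FiniteDimensional ℂ E] {D D' D'' : Distribution E M}

/-- The field of projections onto `D` along `D'`. -/
def projField (h : ∀ x, IsCompl (D x) (D' x)) : EndField E M :=
  fun x ↦ LinearMap.toContinuousLinearMap ((D x).projection (D' x) (h x))

section

variable (h : ∀ x, IsCompl (D x) (D' x))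

lemma projField_mem (x : M) (v : TangentSpace 𝓘(ℂ, E) x) : projField h x v ∈ D x :=
  Submodule.projection_apply_mem (h x) v

lemma projField_of_mem_left {x : M} {v : TangentSpace 𝓘(ℂ, E) x} (hv : v ∈ D x) :
    projField h x v = v :=
  Submodule.projection_apply_of_mem_left (h x) hv

lemma projField_of_mem_right {x : M} {v : TangentSpace 𝓘(ℂ, E) x} (hv : v ∈ D' x) :
    projField h x v = 0 :=
  (Submodule.projection_apply_eq_zero_iff (h x)).2 hv

lemma ker_projField : (projField h).ker = D' :=
  funext fun x ↦ Submodule.ker_projection (h x)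

lemma one_sub_projField : 1 - projField h = projField fun x ↦ (h x).symm := by
  funext x
  ext v
  exact sub_eq_iff_eq_add'.2 (Submodule.projection_add_projection_eq_self (h x) v).symm

lemma one_sub_projField_mem (x : M) (v : TangentSpace 𝓘(ℂ, E) x) :
    (1 - projField h) x v ∈ D' x :=
  one_sub_projField h ▸ projField_mem _ x v

lemma projField_mul_projField_of_left (h' : ∀ x, IsCompl (D x) (D'' x)) :
    projField h * projField h' = projField h' := by
  funext x
  ext v
  exact projField_of_mem_left h (projField_mem h' x v)

lemma projField_mul_projField_of_right (h' : ∀ x, IsCompl (D'' x) (D' x)) :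
    projField h * projField h' = projField h := by
  have hsymm := projField_mul_projField_of_left (fun x ↦ (h x).symm) (fun x ↦ (h' x).symm)
  rw [← one_sub_projField h, ← one_sub_projField h', sub_mul, one_mul, mul_sub, mul_one,
    sub_eq_self] at hsymm
  exact (sub_eq_zero.1 hsymm).symm

lemma projField_mul_projField_symm (h' : ∀ x, IsCompl (D' x) (D'' x)) :
    projField h * projField h' = 0 := by
  funext x
  ext v
  exact projField_of_mem_right h (projField_mem h' x v)

end

variable [IsManifold 𝓘(ℂ, E) ω M] {n : ℕ}

lemma endHolomorphicAt_projField (h : ∀ x, IsCompl (D x) (D' x)) (hn : finrank ℂ E = 2 * n)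
    (hD : IsHolomorphicSubbundle n D) (hD' : IsHolomorphicSubbundle n D') (x : M) :
    EndHolomorphicAt (projField h) x := by
  obtain ⟨U, hU, hxU, s, hs, hsU⟩ := hD x
  obtain ⟨U', hU', hxU', s', hs', hsU'⟩ := hD' x
  have hnear : ∀ᶠ y in 𝓝 x, y ∈ U ∧ y ∈ U' :=
    (hU.eventually_mem hxU).and (hU'.eventually_mem hxU')
  refine endHolomorphicAt_of_frame (ι := Fin n ⊕ Fin n) (e := Sum.elim s s')
    (by simp [hn, two_mul]) ?_ ?_ ?_
  · exact Sum.forall.2 ⟨fun i ↦ (hs i).holomorphicAt hU hxU,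
      fun i ↦ (hs' i).holomorphicAt hU' hxU'⟩
  · filter_upwards [hnear] with y ⟨hy, hy'⟩
    have hdisj : Disjoint (Submodule.span ℂ (Set.range fun i ↦ s i y))
        (Submodule.span ℂ (Set.range fun i ↦ s' i y)) := by
      rw [(hsU y hy).2, (hsU' y hy').2]
      exact (h y).disjoint
    have he : (fun i ↦ Sum.elim s s' i y) = Sum.elim (fun i ↦ s i y) fun i ↦ s' i y :=
      funext (Sum.forall.2 ⟨fun _ ↦ rfl, fun _ ↦ rfl⟩)
    exact he ▸ (hsU y hy).1.sum_type (hsU' y hy').1 hdisj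
  · refine Sum.forall.2 ⟨fun i ↦ ?_, fun i ↦ ?_⟩
    · refine ((hs i).holomorphicAt hU hxU).congr_of_eventuallyEq ?_
      filter_upwards [hnear] with y ⟨hy, _⟩
      exact congrArg _ (projField_of_mem_left h
        ((hsU y hy).2 ▸ Submodule.subset_span ⟨i, rfl⟩))
    · have hzero : HolomorphicAt (0 : VField E M) x := contMDiff_zeroSection ℂ _ x
      refine hzero.congr_of_eventuallyEq ?_
      filter_upwards [hnear] with y ⟨_, hy'⟩
      exact congrArg _ (projField_of_mem_right h
        ((hsU' y hy').2 ▸ Submodule.subset_span ⟨i, rfl⟩))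

end Projections

section Splitting

variable [IsManifold 𝓘(ℂ, E) ω M]

/-- A holomorphic projection `P` on the tangent bundle together with a holomorphic involution `J`
exchanging the image and the kernel of `P`, so that `TM = im P ⊕ ker P ≅ im P ⊗ ℂ²`. -/
structure IsSplitting (P J : EndField E M) : Prop where
  holomorphicP : ∀ x, EndHolomorphicAt P x
  holomorphicJ : ∀ x, EndHolomorphicAt J x
  P_mul_P : P * P = P
  J_mul_J : J * J = 1
  J_mul_P : J * P = (1 - P) * J

/-- The pencil of fields of endomorphisms of a splitting. The kernel of its member with parameter
`l` consists of the vectors `u + l • J u` with `u` in the image of `P`. -/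
def pencil (P J : EndField E M) (l : ℂ) : EndField E M := 1 - P - l • (J * P)

variable [FiniteDimensional ℂ E] {n : ℕ} {S : CP1 → Distribution E M}

lemma IsSplitting.symm {P J : EndField E M} (h : IsSplitting P J) : IsSplitting (1 - P) J where
  holomorphicP x := .sub .one (h.holomorphicP x)
  holomorphicJ := h.holomorphicJ
  P_mul_P := by rw [mul_sub, sub_mul, sub_mul, h.P_mul_P]; simp
  J_mul_J := h.J_mul_J
  J_mul_P := by rw [mul_sub, h.J_mul_P]; noncomm_ring

omit [IsManifold 𝓘(ℂ, E) ω M] [FiniteDimensional ℂ E] in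
lemma mem_ker_pencil {P J : EndField E M} {l : ℂ} {x : M} {v : TangentSpace 𝓘(ℂ, E) x} :
    v ∈ (pencil P J l).ker x ↔ v = P x v + l • J x (P x v) := by
  rw [EndField.mem_ker, ← sub_eq_zero (a := v), ← sub_sub]
  rfl

namespace IsSL2Web

variable {z o i : CP1}

/-- The involution of `TM` that fixes `S o` pointwise and exchanges `S z` and `S i`, as the sum of
the projections onto `S o` along `S i` and along `S z`, minus the identity. -/
def reflection (hS : IsSL2Web n S) (hoi : o ≠ i) (hoz : o ≠ z) : EndField E M :=
  projField (hS.isCompl hoi) + projField (hS.isCompl hoz) - 1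

lemma reflection_mul_projField (hS : IsSL2Web n S) (hzi : z ≠ i) (hoi : o ≠ i) (hoz : o ≠ z) :
    hS.reflection hoi hoz * projField (hS.isCompl hzi) =
      projField (hS.isCompl hoi) - projField (hS.isCompl hzi) := by
  rw [reflection, sub_mul, add_mul, projField_mul_projField_of_right,
    projField_mul_projField_symm, one_mul, add_zero]

lemma isSplitting (hS : IsSL2Web n S) (hzi : z ≠ i) (hoi : o ≠ i) (hoz : o ≠ z) :
    IsSplitting (projField (hS.isCompl hzi)) (hS.reflection hoi hoz) := by
  have hol {t t' : CP1} (h : t ≠ t') (x : M) : EndHolomorphicAt (projField (hS.isCompl h)) x :=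
    endHolomorphicAt_projField _ hS.dim_eq (hS.subbundle t) (hS.subbundle t') x
  refine ⟨hol hzi, fun x ↦ ((hol hoi x).add (hol hoz x)).sub .one,
    projField_mul_projField_of_left _ _, ?_, ?_⟩
  · simp only [reflection, add_mul, mul_add, sub_mul, mul_sub, projField_mul_projField_of_left,
      one_mul, mul_one]
    abel
  · have hright : (1 - projField (hS.isCompl hzi)) * projField (hS.isCompl hoz) =
        1 - projField (hS.isCompl hzi) := by
      rw [one_sub_projField, projField_mul_projField_of_right]
    have hleft : projField (hS.isCompl hzi) * projField (hS.isCompl hoi) =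
      projField (hS.isCompl hzi) := projField_mul_projField_of_right _ _
    rw [hS.reflection_mul_projField hzi, reflection, mul_sub, mul_add, hright, mul_one, sub_mul,
      one_mul, hleft]
    abel

lemma injective [Nonempty M] (hS : IsSL2Web n S) : Function.Injective S := by
  intro t t' h
  by_contra hne
  have hx := hS.transversal t t' hne (Classical.arbitrary M)
  rw [h, inf_idem] at hx
  exact hS.ne_bot t' _ hx

end IsSL2Web

namespace GeneratesWeb

variable {Ω : Submodule ℂ (TwoForm E M)}

lemma exists_ker_pencil_eq (hΩ : GeneratesWeb Ω S) (hS : IsSL2Web n S) {z o i t : CP1}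
    (hzi : z ≠ i) (hoi : o ≠ i) (hoz : o ≠ z) (hti : t ≠ i) :
    ∃ l, (pencil (projField (hS.isCompl hzi)) (hS.reflection hoi hoz) l).ker = S t := by
  obtain ⟨l, hl⟩ := hΩ.exists_add_smul_mem hS hzi hoz hti
  refine ⟨l, funext fun x ↦ Submodule.ext fun v ↦ ?_⟩
  set P := projField (hS.isCompl hzi)
  set J := hS.reflection hoi hoz
  have h : IsSplitting P J := hS.isSplitting hzi hoi hoz
  have hJPv : J x (P x v) ∈ S i x := by
    rw [show J x (P x v) = (1 - P) x (J x v) from congr($(h.J_mul_P) x v)]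
    exact one_sub_projField_mem _ x (J x v)
  have hsum : P x v + J x (P x v) ∈ S o x := by
    rw [show J x (P x v) = projField (hS.isCompl hoi) x v - P x v from
      congr($(hS.reflection_mul_projField hzi hoi hoz) x v), add_sub_cancel]
    exact projField_mem _ x v
  have hgraph : P x v + l • J x (P x v) ∈ S t x := hl x _ (projField_mem _ x v) _ hJPv hsum
  refine mem_ker_pencil.trans ⟨fun hv ↦ hv ▸ hgraph, fun hv ↦ sub_eq_zero.1 ?_⟩
  refine Submodule.disjoint_def.1 (hS.isCompl hti x).disjoint _ (sub_mem hv hgraph) ?_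
  rw [← sub_sub]
  exact sub_mem (one_sub_projField_mem (hS.isCompl hzi) x v) (Submodule.smul_mem _ l hJPv)

lemma exists_isSplitting (hΩ : GeneratesWeb Ω S) (hS : IsSL2Web n S) :
    ∃ (P J : EndField E M) (i : CP1) (l : CP1 → ℂ), IsSplitting P J ∧ P.ker = S i ∧
      (∀ t ≠ i, (pencil P J (l t)).ker = S t) ∧ (l '' {i}ᶜ).Infinite := by
  have := hΩ.nonempty
  obtain ⟨i, z, hzi⟩ := exists_pair_ne CP1
  obtain ⟨o, ho⟩ := (Set.toFinite {i, z}).exists_notMem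
  simp only [Set.mem_insert_iff, Set.mem_singleton_iff, not_or] at ho
  obtain ⟨hoi, hoz⟩ := ho
  have hpencil (t : CP1) (ht : t ≠ i) :=
    hΩ.exists_ker_pencil_eq hS (Ne.symm hzi) hoi hoz ht
  choose! l hl using hpencil
  refine ⟨_, _, i, l, hS.isSplitting (Ne.symm hzi) hoi hoz, ker_projField _, hl, ?_⟩
  refine (Set.finite_singleton i).infinite_compl.image fun t ht t' ht' h ↦ hS.injective ?_
  rw [← hl t ht, ← hl t' ht', h]

end GeneratesWeb

end Splitting

end Splittings

section Connection

open VectorField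

variable {E : Type*} [NormedAddCommGroup E] [NormedSpace ℂ E]
  {M : Type*} [TopologicalSpace M] [ChartedSpace E M] [IsManifold 𝓘(ℂ, E) ω M]

section Parallel

variable {cov : CovariantDerivative 𝓘(ℂ, E) E (TangentSpace 𝓘(ℂ, E) : M → Type _)}
  {A B : EndField E M}

/-- The field of endomorphisms `A` is holomorphic and parallel with respect to the connection, where
`∇A = 0` is expressed as `∇(AY) = A(∇Y)`. -/
structure IsParallelEnd
    (cov : CovariantDerivative 𝓘(ℂ, E) E (TangentSpace 𝓘(ℂ, E) : M → Type _))
    (A : EndField E M) : Prop where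
  holomorphic : ∀ x, EndHolomorphicAt A x
  comm : ∀ {Y : VField E M} {x : M}, DiffAt Y x → ∀ v, cov (A.app Y) x v = A x (cov Y x v)

lemma IsParallelEnd.preserves_ker (hA : IsParallelEnd cov A) : Preserves cov A.ker := by
  intro U hU X hX hXA x hx v
  have hAX : A.app X =ᶠ[𝓝 x] 0 := Filter.eventually_of_mem (hU.mem_nhds hx) hXA
  have hcov : cov (A.app X) x = cov 0 x :=
    cov.isCovariantDerivativeOn.congr_of_eventuallyEq
      ((hA.holomorphic x).app (hX.holomorphicAt hU hx)).diffAt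
      (mdifferentiableAt_zeroSection ..) Filter.univ_mem hAX
  rw [EndField.mem_ker, ← hA.comm (hX.holomorphicAt hU hx).diffAt, hcov,
    cov.isCovariantDerivativeOn.zero]
  rfl

variable [FiniteDimensional ℂ E]

lemma IsParallelEnd.one : IsParallelEnd cov (1 : EndField E M) :=
  ⟨fun _ ↦ .one, fun _ _ ↦ rfl⟩

lemma IsParallelEnd.mul (hA : IsParallelEnd cov A) (hB : IsParallelEnd cov B) :
    IsParallelEnd cov (A * B) where
  holomorphic x := (hA.holomorphic x).mul (hB.holomorphic x)
  comm {_ x} hY v :=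
    (hA.comm ((hB.holomorphic x).diffAt_app hY) v).trans (congrArg (A x) (hB.comm hY v))

lemma IsParallelEnd.add (hA : IsParallelEnd cov A) (hB : IsParallelEnd cov B) :
    IsParallelEnd cov (A + B) where
  holomorphic x := (hA.holomorphic x).add (hB.holomorphic x)
  comm {Y x} hY v := by
    have hadd := cov.isCovariantDerivativeOn.add ((hA.holomorphic x).diffAt_app hY)
      ((hB.holomorphic x).diffAt_app hY)
    exact congr($hadd v).trans (congrArg₂ (· + ·) (hA.comm hY v) (hB.comm hY v))

lemma IsParallelEnd.const_smul (c : ℂ) (hA : IsParallelEnd cov A) : IsParallelEnd cov (c • A) where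
  holomorphic x := (hA.holomorphic x).const_smul c
  comm {Y x} hY v := by
    have hsmul := cov.isCovariantDerivativeOn.smul_const c ((hA.holomorphic x).diffAt_app hY)
    exact congr($hsmul v).trans (congrArg (c • ·) (hA.comm hY v))

lemma IsParallelEnd.sub (hA : IsParallelEnd cov A) (hB : IsParallelEnd cov B) :
    IsParallelEnd cov (A - B) := by
  rw [sub_eq_add_neg, ← neg_one_smul ℂ]
  exact hA.add (hB.const_smul (-1))

end Parallel

lemma IsInvolutive.mlieBracket_mem {D : Distribution E M} (hD : IsInvolutive D) {X Y : VField E M}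
    {x : M} (hX : HolomorphicAt X x) (hY : HolomorphicAt Y x) (hXD : ∀ y, X y ∈ D y)
    (hYD : ∀ y, Y y ∈ D y) : mlieBracket 𝓘(ℂ, E) X Y x ∈ D x := by
  obtain ⟨U, hU, hxU, hXU⟩ := hX.exists_holomorphicOn
  obtain ⟨V, hV, hxV, hYV⟩ := hY.exists_holomorphicOn
  exact hD (U ∩ V) (hU.inter hV) X Y (hXU.mono Set.inter_subset_left)
    (hYV.mono Set.inter_subset_right) (fun y _ ↦ hXD y) (fun y _ ↦ hYD y) x ⟨hxU, hxV⟩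

lemma eq_zero_of_infinite_add_smul_add_sq_smul {K V : Type*} [Field K] [AddCommGroup V] [Module K V]
    {a b c : V} (h : {l : K | a + l • b + l ^ 2 • c = 0}.Infinite) : a = 0 ∧ b = 0 ∧ c = 0 := by
  obtain ⟨p, hp⟩ := h.nonempty
  obtain ⟨q, hq, hqp⟩ := h.exists_notMem_finite (Set.finite_singleton p)
  obtain ⟨r, hr, hrpq⟩ := h.exists_notMem_finite (Set.toFinite {p, q})
  rw [Set.mem_insert_iff, Set.mem_singleton_iff, not_or] at hrpq
  have hdiff {s t : K} (hst : s ≠ t) (hs : a + s • b + s ^ 2 • c = 0)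
      (ht : a + t • b + t ^ 2 • c = 0) : b + (s + t) • c = 0 := by
    refine (smul_eq_zero.1 ?_).resolve_left (sub_ne_zero.2 hst)
    linear_combination (norm := module) hs - ht
  have hpq := hdiff hqp hq hp
  have hpr := hdiff hrpq.1 hr hp
  have hc : c = 0 := by
    refine (smul_eq_zero.1 ?_).resolve_left (sub_ne_zero.2 hrpq.2)
    linear_combination (norm := module) hpr - hpq
  have hb : b = 0 := by simpa only [hc, smul_zero, add_zero] using hpq
  refine ⟨?_, hb, hc⟩
  simpa only [hb, hc, smul_zero, add_zero, Set.mem_ofPred_eq] using hp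

variable {P J : EndField E M}

variable (P J) in
/-- The component `P([QX, PY] + J[PX, JPY])` in the image of `P` of the connection of a splitting,
where `Q = 1 - P`. -/
def halfConnection (X Y : VField E M) : VField E M := fun x ↦
  P x (mlieBracket 𝓘(ℂ, E) ((1 - P).app X) (P.app Y) x +
    J x (mlieBracket 𝓘(ℂ, E) (P.app X) (J.app (P.app Y)) x))

namespace IsSplitting

variable (h : IsSplitting P J)
include h

section Pointwise

variable {x : M} (v : TangentSpace 𝓘(ℂ, E) x)

lemma P_P : P x (P x v) = P x v := congr($(h.P_mul_P) x v)

lemma P_Q : P x ((1 - P) x v) = 0 := by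
  change P x (v - P x v) = 0
  rw [map_sub, h.P_P, sub_self]

lemma Q_P : (1 - P) x (P x v) = 0 := sub_eq_zero.2 (h.P_P v).symm

lemma J_J : J x (J x v) = v := congr($(h.J_mul_J) x v)

lemma J_P : J x (P x v) = (1 - P) x (J x v) := congr($(h.J_mul_P) x v)

lemma P_J : P x (J x v) = J x ((1 - P) x v) := by
  change _ = J x (v - P x v)
  rw [map_sub, h.J_P]
  exact (sub_sub_cancel _ _).symm

end Pointwise

variable {X Y Y' : VField E M} {f : M → ℂ} {x : M}

lemma exists_section (u : TangentSpace 𝓘(ℂ, E) x) :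
    ∃ X : VField E M, HolomorphicAt X x ∧ P.app X = X ∧ X x = P x u :=
  ⟨P.app (FiberBundle.extend E u),
    (h.holomorphicP x).app (FiberBundle.contMDiffAt_extend 𝓘(ℂ, E) E u),
    funext fun y ↦ h.P_P _, by rw [EndField.app, FiberBundle.extend_apply_self]⟩

lemma halfConnection_app_J : halfConnection (1 - P) J X (J.app Y) x =
    J x (halfConnection P J X Y x) := by
  have hQJ : (1 - P).app (J.app Y) = J.app (P.app Y) := funext fun y ↦ (h.J_P (Y y)).symm
  have hJJ : J.app (J.app (P.app Y)) = P.app Y := funext fun y ↦ h.J_J _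
  simp only [halfConnection, hQJ, hJJ, sub_sub_cancel, h.J_P, map_add, h.J_J]
  exact add_comm _ _

lemma halfConnection_of_range (hY : P.app Y = Y) : halfConnection (1 - P) J X Y x = 0 := by
  have hQY : (1 - P).app Y = 0 := funext fun y ↦ by
    rw [← hY]
    exact h.Q_P (Y y)
  simp only [halfConnection, hQY, EndField.app_zero, mlieBracket_zero_right, Pi.zero_apply,
    map_zero, add_zero]

variable [CompleteSpace E]

lemma halfConnection_add_right (hY : DiffAt Y x) (hY' : DiffAt Y' x) :
    halfConnection P J X (Y + Y') x = halfConnection P J X Y x + halfConnection P J X Y' x := by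
  have hP {Z : VField E M} (hZ : DiffAt Z x) := (h.holomorphicP x).diffAt_app hZ
  have hJ {Z : VField E M} (hZ : DiffAt Z x) := (h.holomorphicJ x).diffAt_app hZ
  simp only [halfConnection, EndField.app_add, mlieBracket_add_right (hP hY) (hP hY'),
    mlieBracket_add_right (hJ (hP hY)) (hJ (hP hY')), map_add]
  abel

lemma halfConnection_smul_right (hf : MDifferentiableAt 𝓘(ℂ, E) 𝓘(ℂ, ℂ) f x)
    (hY : DiffAt Y x) : halfConnection P J X (f • Y) x =
      f x • halfConnection P J X Y x + mvfderiv 𝓘(ℂ, E) f x (X x) • P x (Y x) := by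
  have hP := (h.holomorphicP x).diffAt_app hY
  have hJ := (h.holomorphicJ x).diffAt_app hP
  have hX : mvfderiv 𝓘(ℂ, E) f x ((1 - P) x (X x)) + mvfderiv 𝓘(ℂ, E) f x (P x (X x)) =
      mvfderiv 𝓘(ℂ, E) f x (X x) := by
    rw [← map_add]
    exact congrArg _ (sub_add_cancel _ _)
  simp only [halfConnection, EndField.app_smul, mlieBracket_smul_right hf hP,
    mlieBracket_smul_right hf hJ, map_add, map_smul, EndField.app, h.P_P, h.J_J, ← hX]
  module

lemma mlieBracket_add_smul_app_J (hX : DiffAt X x) (hY : DiffAt Y x) (l : ℂ) :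
    mlieBracket 𝓘(ℂ, E) (X + l • J.app X) (Y + l • J.app Y) x = mlieBracket 𝓘(ℂ, E) X Y x +
      l • (mlieBracket 𝓘(ℂ, E) X (J.app Y) x + mlieBracket 𝓘(ℂ, E) (J.app X) Y x) +
        l ^ 2 • mlieBracket 𝓘(ℂ, E) (J.app X) (J.app Y) x := by
  have hJ {Z : VField E M} (hZ : DiffAt Z x) := (h.holomorphicJ x).diffAt_app hZ
  have hl {Z : VField E M} (hZ : DiffAt Z x) : DiffAt (l • J.app Z) x :=
    (mdifferentiableAt_const (c := l)).smul_section (hJ hZ)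
  rw [mlieBracket_add_left hX (hl hX), mlieBracket_add_right hY (hl hY),
    mlieBracket_add_right hY (hl hY), mlieBracket_const_smul_left (hJ hX),
    mlieBracket_const_smul_left (hJ hX), mlieBracket_const_smul_right (hJ hY),
    mlieBracket_const_smul_right (hJ hY)]
  module

/-- The involutivity of the pencil, applied to the sections `X + lJX` and `Y + lJY`, is polynomial
in `l`, so that its coefficients vanish. -/
lemma bracket_relations (hP : IsInvolutive P.ker)
    (hpencil : {l | IsInvolutive (pencil P J l).ker}.Infinite) (hX : HolomorphicAt X x)
    (hY : HolomorphicAt Y x) (hPX : P.app X = X) (hPY : P.app Y = Y) :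
    (1 - P) x (mlieBracket 𝓘(ℂ, E) X Y x) = 0 ∧
      (1 - P) x (mlieBracket 𝓘(ℂ, E) X (J.app Y) x + mlieBracket 𝓘(ℂ, E) (J.app X) Y x) =
        J x (P x (mlieBracket 𝓘(ℂ, E) X Y x)) ∧
      mlieBracket 𝓘(ℂ, E) (J.app X) (J.app Y) x =
        J x (P x (mlieBracket 𝓘(ℂ, E) X (J.app Y) x + mlieBracket 𝓘(ℂ, E) (J.app X) Y x)) := by
  have hJX := (h.holomorphicJ x).app hX
  have hJY := (h.holomorphicJ x).app hY
  have hPJ {Z : VField E M} (hZ : P.app Z = Z) (y : M) : P y (J y (Z y)) = 0 := by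
    rw [← congrFun hZ y, EndField.app, h.J_P, h.P_Q]
  have hk : P x (mlieBracket 𝓘(ℂ, E) (J.app X) (J.app Y) x) = 0 :=
    hP.mlieBracket_mem hJX hJY (hPJ hPX) (hPJ hPY)
  have hmem {Z : VField E M} (hZ : P.app Z = Z) (l : ℂ) (y : M) :
      (Z + l • J.app Z) y ∈ (pencil P J l).ker y := by
    have hPZ : P y ((Z + l • J.app Z) y) = Z y := by
      change P y (Z y + l • J y (Z y)) = Z y
      rw [map_add, map_smul, hPJ hZ, smul_zero, add_zero]
      exact congrFun hZ y
    rw [mem_ker_pencil, hPZ]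
    rfl
  have hhol {Z : VField E M} (hZ : HolomorphicAt Z x) (l : ℂ) : HolomorphicAt (Z + l • J.app Z) x :=
    hZ.add_section ((contMDiffAt_const (c := l)).smul_section ((h.holomorphicJ x).app hZ))
  rw [← sub_eq_zero (b := J x _), ← sub_eq_zero (b := J x (P x (_ + _)))]
  refine eq_zero_of_infinite_add_smul_add_sq_smul (hpencil.mono fun l hl ↦ ?_)
  have hbr := hl.mlieBracket_mem (hhol hX l) (hhol hY l) (hmem hPX l) (hmem hPY l)
  rw [h.mlieBracket_add_smul_app_J hX.diffAt hY.diffAt, mem_ker_pencil] at hbr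
  simp only [map_add, map_smul, hk, smul_zero, add_zero] at hbr
  have hQ (w : TangentSpace 𝓘(ℂ, E) x) : (1 - P) x w = w - P x w := rfl
  simp only [Set.mem_ofPred_eq, hQ, map_add]
  linear_combination (norm := module) hbr

variable [FiniteDimensional ℂ E]

lemma tensorialAt_halfConnection :
    TensorialAt 𝓘(ℂ, E) E (fun X ↦ halfConnection P J X Y x) x where
  smul hf hX := by
    have hP := (h.holomorphicP x).diffAt_app hX
    have hQ := (h.symm.holomorphicP x).diffAt_app hX
    simp only [halfConnection, EndField.app_smul, mlieBracket_smul_left hf hP,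
      mlieBracket_smul_left hf hQ, map_add, map_smul, EndField.app, h.P_Q, h.J_P,
      smul_zero, zero_add, smul_add]
  add hX hX' := by
    have hP {Z : VField E M} (hZ : DiffAt Z x) := (h.holomorphicP x).diffAt_app hZ
    have hQ {Z : VField E M} (hZ : DiffAt Z x) := (h.symm.holomorphicP x).diffAt_app hZ
    simp only [halfConnection, EndField.app_add, mlieBracket_add_left (hP hX) (hP hX'),
      mlieBracket_add_left (hQ hX) (hQ hX'), map_add]
    abel

lemma holomorphicAt_halfConnection (hX : HolomorphicAt X x) (hY : HolomorphicAt Y x) :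
    HolomorphicAt (halfConnection P J X Y) x := by
  have hPX := (h.holomorphicP x).app hX
  have hPY := (h.holomorphicP x).app hY
  have hJPY := (h.holomorphicJ x).app hPY
  exact (h.holomorphicP x).app ((((h.symm.holomorphicP x).app hX).mlieBracket hPY).add_section
    ((h.holomorphicJ x).app (hPX.mlieBracket hJPY)))

/-- The connection `∇_X Y = P([QX, PY] + J[PX, JPY]) + Q([PX, QY] + J[QX, JQY])` of a splitting,
where `Q = 1 - P`. -/
def connection : CovariantDerivative 𝓘(ℂ, E) E (TangentSpace 𝓘(ℂ, E) : M → Type _) where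
  toFun Y x := TensorialAt.mkHom (fun X ↦ halfConnection P J X Y x) x
      h.tensorialAt_halfConnection +
    TensorialAt.mkHom (fun X ↦ halfConnection (1 - P) J X Y x) x h.symm.tensorialAt_halfConnection
  isCovariantDerivativeOnUniv :=
    { add := fun {Y Y' x} hY hY' _ ↦ by
        ext v
        simp only [TensorialAt.mkHom_apply_eq_extend, _root_.add_apply,
          h.halfConnection_add_right hY hY', h.symm.halfConnection_add_right hY hY']
        abel
      leibniz := fun {Y f x} hY hf _ ↦ by
        ext v
        have hYx : Y x = P x (Y x) + (1 - P) x (Y x) := (add_sub_cancel _ _).symm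
        simp only [TensorialAt.mkHom_apply_eq_extend, _root_.add_apply,
          _root_.smul_apply, ContinuousLinearMap.smulRight_apply, h.halfConnection_smul_right hf hY,
          h.symm.halfConnection_smul_right hf hY, FiberBundle.extend_apply_self]
        nth_rw 3 [hYx]
        module }

lemma connection_apply (hX : DiffAt X x) :
    h.connection Y x (X x) = halfConnection P J X Y x + halfConnection (1 - P) J X Y x :=
  congrArg₂ (· + ·) (TensorialAt.mkHom_apply h.tensorialAt_halfConnection hX)
    (TensorialAt.mkHom_apply h.symm.tensorialAt_halfConnection hX)

lemma connection_apply_eq_extend (v : TangentSpace 𝓘(ℂ, E) x) :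
    h.connection Y x v = halfConnection P J (FiberBundle.extend E v) Y x +
      halfConnection (1 - P) J (FiberBundle.extend E v) Y x := rfl

lemma isHolomorphicConnection_connection : IsHolomorphicConnection h.connection := by
  refine fun U hU ↦ ⟨fun {Y} hY x hx ↦ ContMDiffAt.contMDiffWithinAt ?_⟩
  have hYx : HolomorphicAt Y x := HolomorphicOn.holomorphicAt (U := U) hY hU hx
  refine endHolomorphicAt_of_forall (A := h.connection Y) fun X hX ↦ ?_
  refine ((h.holomorphicAt_halfConnection hX hYx).add_section
    (h.symm.holomorphicAt_halfConnection hX hYx)).congr_of_eventuallyEq ?_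
  filter_upwards [(contMDiffAt_iff_contMDiffAt_nhds (by simp)).1 hX] with y hy
  exact congrArg _ (h.connection_apply (HolomorphicAt.diffAt hy))

lemma isParallelEnd_P : IsParallelEnd h.connection P where
  holomorphic := h.holomorphicP
  comm {Y x} _ v := by
    have hPP : P.app (P.app Y) = P.app Y := funext fun y ↦ h.P_P (Y y)
    rw [connection_apply_eq_extend, connection_apply_eq_extend, h.halfConnection_of_range hPP,
      add_zero, map_add]
    simp only [halfConnection, hPP, h.P_P, h.P_Q, add_zero]

lemma isParallelEnd_J : IsParallelEnd h.connection J where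
  holomorphic := h.holomorphicJ
  comm {Y x} _ v := by
    have hQ : halfConnection P J (FiberBundle.extend E v) (J.app Y) x =
        J x (halfConnection (1 - P) J (FiberBundle.extend E v) Y x) := by
      simpa only [sub_sub_cancel] using
        h.symm.halfConnection_app_J (X := FiberBundle.extend E v) (Y := Y) (x := x)
    rw [connection_apply_eq_extend, connection_apply_eq_extend, h.halfConnection_app_J, hQ, map_add,
      add_comm]

lemma isParallelEnd_pencil (l : ℂ) : IsParallelEnd h.connection (pencil P J l) :=
  (IsParallelEnd.one.sub h.isParallelEnd_P).sub
    ((h.isParallelEnd_J.mul h.isParallelEnd_P).const_smul l)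

lemma connection_symm : h.symm.connection = h.connection := by
  ext Y x v
  simp only [connection_apply_eq_extend, sub_sub_cancel]
  exact add_comm _ _

lemma torsion_apply_of_range (hX : DiffAt X x) (hY : DiffAt Y x) (hPX : P.app X = X)
    (hPY : P.app Y = Y) : h.connection.torsion x (X x) (Y x) =
      P x (J x (mlieBracket 𝓘(ℂ, E) X (J.app Y) x + mlieBracket 𝓘(ℂ, E) (J.app X) Y x)) -
        mlieBracket 𝓘(ℂ, E) X Y x := by
  have hQ {Z : VField E M} (hZ : P.app Z = Z) : (1 - P).app Z = 0 := funext fun y ↦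
    sub_eq_zero.2 (congrFun hZ y).symm
  rw [h.connection.torsion_apply hX hY, h.connection_apply hX, h.connection_apply hY,
    h.halfConnection_of_range hPX, h.halfConnection_of_range hPY]
  simp only [halfConnection, hPX, hPY, hQ hPX, hQ hPY, mlieBracket_zero_left, Pi.zero_apply,
    zero_add, add_zero]
  rw [mlieBracket_swap_apply (V := Y), map_neg, map_neg, sub_neg_eq_add, ← map_add, ← map_add]

lemma torsion_apply_of_range_of_ker (hX : DiffAt X x) (hY : DiffAt Y x) (hPX : P.app X = X)
    (hQY : (1 - P).app Y = Y) : h.connection.torsion x (X x) (Y x) = 0 := by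
  have hQX : (1 - P).app X = 0 := funext fun y ↦ sub_eq_zero.2 (congrFun hPX y).symm
  have hPY : P.app Y = 0 := funext fun y ↦ sub_eq_self.1 (congrFun hQY y)
  rw [h.connection.torsion_apply hX hY, h.connection_apply hX, h.connection_apply hY]
  simp only [halfConnection, sub_sub_cancel, hPX, hQX, hPY, hQY, EndField.app_zero,
    mlieBracket_zero_left, mlieBracket_zero_right, Pi.zero_apply, map_zero, zero_add, add_zero]
  rw [mlieBracket_swap_apply (V := Y), map_neg, sub_neg_eq_add]
  exact sub_eq_zero.2 (sub_add_cancel _ _)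

lemma torsion_connection (hP : IsInvolutive P.ker)
    (hpencil : {l | IsInvolutive (pencil P J l).ker}.Infinite) : h.connection.torsion = 0 := by
  have hPP {x : M} (u v : TangentSpace 𝓘(ℂ, E) x) :
      h.connection.torsion x (P x u) (P x v) = 0 := by
    obtain ⟨X, hX, hPX, hXu⟩ := h.exists_section u
    obtain ⟨Y, hY, hPY, hYv⟩ := h.exists_section v
    obtain ⟨hb, hc, -⟩ := h.bracket_relations hP hpencil hX hY hPX hPY
    rw [← hXu, ← hYv, h.torsion_apply_of_range hX.diffAt hY.diffAt hPX hPY, h.P_J, hc, h.J_J,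
      ← neg_sub]
    exact neg_eq_zero.2 hb
  have hPQ {x : M} (u v : TangentSpace 𝓘(ℂ, E) x) :
      h.connection.torsion x (P x u) ((1 - P) x v) = 0 := by
    obtain ⟨X, hX, hPX, hXu⟩ := h.exists_section u
    obtain ⟨Y, hY, hQY, hYv⟩ := h.symm.exists_section v
    rw [← hXu, ← hYv, h.torsion_apply_of_range_of_ker hX.diffAt hY.diffAt hPX hQY]
  have hQQ {x : M} (u v : TangentSpace 𝓘(ℂ, E) x) :
      h.connection.torsion x ((1 - P) x u) ((1 - P) x v) = 0 := by
    obtain ⟨X, hX, hQX, hXu⟩ := h.symm.exists_section u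
    obtain ⟨Y, hY, hQY, hYv⟩ := h.symm.exists_section v
    have hJJ (Z : VField E M) : J.app (J.app Z) = Z := funext fun y ↦ h.J_J _
    have hPJ {Z : VField E M} (hZ : (1 - P).app Z = Z) : P.app (J.app Z) = J.app Z := by
      nth_rw 2 [← hZ]
      exact funext fun y ↦ h.P_J _
    obtain ⟨-, -, hk⟩ := h.bracket_relations hP hpencil ((h.holomorphicJ x).app hX)
      ((h.holomorphicJ x).app hY) (hPJ hQX) (hPJ hQY)
    rw [hJJ, hJJ, h.J_P] at hk
    rw [← hXu, ← hYv, ← h.connection_symm,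
      h.symm.torsion_apply_of_range hX.diffAt hY.diffAt hQX hQY, add_comm, ← hk, sub_self]
  ext x u v
  have huv (w : TangentSpace 𝓘(ℂ, E) x) : P x w + (1 - P) x w = w := add_sub_cancel _ _
  change h.connection.torsion x u v = 0
  rw [← huv u, ← huv v]
  simp only [map_add, _root_.add_apply, hPP, hPQ, hQQ,
    h.connection.torsion_antisymm ((1 - P) x u) (P x v), neg_zero, add_zero]

end IsSplitting

theorem GeneratesWeb.exists_isChernConnection [FiniteDimensional ℂ E] [CompleteSpace E] {n : ℕ}
    {S : CP1 → Distribution E M} {Ω : Submodule ℂ (TwoForm E M)} (hΩ : GeneratesWeb Ω S)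
    (hS : IsSL2Web n S) :
    ∃ cov : CovariantDerivative 𝓘(ℂ, E) E (TangentSpace 𝓘(ℂ, E) : M → Type _),
      IsChernConnection S cov := by
  obtain ⟨P, J, i, l, h, hi, hl, hinf⟩ := hΩ.exists_isSplitting hS
  have hpencil : {c | IsInvolutive (pencil P J c).ker}.Infinite := by
    refine hinf.mono ?_
    rintro _ ⟨t, ht, rfl⟩
    rw [Set.mem_ofPred_eq, hl t ht]
    exact hS.involutive t
  refine ⟨h.connection, h.isHolomorphicConnection_connection,
    h.torsion_connection (hi ▸ hS.involutive i) hpencil, fun t ↦ ?_⟩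
  by_cases hti : t = i
  · rw [hti, ← hi]
    exact h.isParallelEnd_P.preserves_ker
  · rw [← hl t hti]
    exact (h.isParallelEnd_pencil (l t)).preserves_ker

end Connection

section Charts

variable {E : Type*} [NormedAddCommGroup E] [NormedSpace ℂ E]
  {M : Type*} [TopologicalSpace M] [ChartedSpace E M] {η θ : TwoForm E M}

lemma TwoForm.IsHolomorphic.add (hη : η.IsHolomorphic) (hθ : θ.IsHolomorphic) :
    (η + θ).IsHolomorphic := fun x ↦ (hη x).add (hθ x)

lemma TwoForm.IsHolomorphic.const_smul (c : ℂ) (hη : η.IsHolomorphic) : (c • η).IsHolomorphic :=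
  fun x ↦ (hη x).const_smul c

lemma TwoForm.IsHolomorphic.differentiableAt (hη : η.IsHolomorphic) (x : M) :
    DifferentiableAt ℂ (η.inChart x) (extChartAt 𝓘(ℂ, E) x x) :=
  ((hη x).differentiableOn (by simp)).differentiableAt (extChartAt_target_mem_nhds x)

variable [IsManifold 𝓘(ℂ, E) ω M] {x y : M}

variable (x) in
/-- The coordinates of a tangent vector in the trivialization of `TM` given by the chart at `x`. -/
def coord (v : TangentSpace 𝓘(ℂ, E) y) : E :=
  (trivializationAt E (TangentSpace 𝓘(ℂ, E) : M → Type _) x ⟨y, v⟩).2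

lemma mfderiv_symm_coord {z : E} (hz : z ∈ (extChartAt 𝓘(ℂ, E) x).target)
    (v : TangentSpace 𝓘(ℂ, E) ((extChartAt 𝓘(ℂ, E) x).symm z)) :
    mfderiv 𝓘(ℂ, E) 𝓘(ℂ, E) (extChartAt 𝓘(ℂ, E) x).symm z (coord (E := E) x v) = v := by
  set t := trivializationAt E (TangentSpace 𝓘(ℂ, E) : M → Type _) x
  have hs := (extChartAt 𝓘(ℂ, E) x).map_target hz
  have hb : (extChartAt 𝓘(ℂ, E) x).symm z ∈ t.baseSet := by simpa [t] using hs
  have h := TangentBundle.symmL_trivializationAt (I := 𝓘(ℂ, E)) (x₀ := x)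
    (x := (extChartAt 𝓘(ℂ, E) x).symm z) (by simpa using hs)
  rw [ModelWithCorners.range_eq_univ, mfderivWithin_univ, (extChartAt 𝓘(ℂ, E) x).right_inv hz] at h
  rw [← h]
  exact (t.symmL_apply (R := ℂ) hb _).trans (t.symm_apply_apply_mk hb v)

lemma coord_self (v : TangentSpace 𝓘(ℂ, E) x) :
    coord x v = mfderiv 𝓘(ℂ, E) 𝓘(ℂ, E) (extChartAt 𝓘(ℂ, E) x) x v := by
  rw [← TangentBundle.continuousLinearMapAt_trivializationAt (by simp)]
  exact congrFun (((trivializationAt E (TangentSpace 𝓘(ℂ, E) : M → Type _) x).coe_linearMapAt_of_mem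
    (R := ℂ) (FiberBundle.mem_baseSet_trivializationAt' x)).symm) v

lemma coord_extend (hy : y ∈ (extChartAt 𝓘(ℂ, E) x).source) (v : TangentSpace 𝓘(ℂ, E) x) :
    coord x (FiberBundle.extend E v y) = coord x v := by
  set t := trivializationAt E (TangentSpace 𝓘(ℂ, E) : M → Type _) x
  have hb : y ∈ t.baseSet := by simpa [t] using hy
  change (t ⟨y, t.symm y (coord x v)⟩).2 = _
  rw [t.apply_mk_symm hb]

lemma TwoForm.apply_eq_inChart (η : TwoForm E M) (hy : y ∈ (extChartAt 𝓘(ℂ, E) x).source)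
    (v w : TangentSpace 𝓘(ℂ, E) y) :
    η y ![v, w] = η.inChart x (extChartAt 𝓘(ℂ, E) x y) ![coord x v, coord x w] := by
  obtain ⟨z, hz, rfl⟩ : ∃ z ∈ (extChartAt 𝓘(ℂ, E) x).target, (extChartAt 𝓘(ℂ, E) x).symm z = y :=
    ⟨_, (extChartAt 𝓘(ℂ, E) x).map_source hy, (extChartAt 𝓘(ℂ, E) x).left_inv hy⟩
  rw [(extChartAt 𝓘(ℂ, E) x).right_inv hz, TwoForm.inChart]
  change _ = η _ (_ ∘ _)
  congr 1
  ext i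
  fin_cases i
  exacts [(mfderiv_symm_coord hz v).symm, (mfderiv_symm_coord hz w).symm]

lemma TwoForm.IsHolomorphic.mdifferentiableAt_apply (hη : η.IsHolomorphic) {Y Z : VField E M}
    (hY : DiffAt Y x) (hZ : DiffAt Z x) :
    MDifferentiableAt 𝓘(ℂ, E) 𝓘(ℂ, ℂ) (fun y ↦ η y ![Y y, Z y]) x := by
  have heval : DifferentiableAt ℂ (fun p : E × E × E ↦ η.inChart x p.1 ![p.2.1, p.2.2])
      (extChartAt 𝓘(ℂ, E) x x, coord x (Y x), coord x (Z x)) := by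
    have hform : DifferentiableAt ℂ (fun p : E × E × E ↦
        ContinuousAlternatingMap.toContinuousMultilinearMapCLM ℂ (η.inChart x p.1))
        (extChartAt 𝓘(ℂ, E) x x, coord x (Y x), coord x (Z x)) :=
      (ContinuousLinearMap.differentiableAt _).comp _ ((hη.differentiableAt x).comp (f := Prod.fst)
        (extChartAt 𝓘(ℂ, E) x x, coord x (Y x), coord x (Z x)) differentiableAt_fst)
    refine (hform.hasFDerivAt.continuousMultilinearMap_apply
      (g := fun i p ↦ ![p.2.1, p.2.2] i) fun i ↦ DifferentiableAt.hasFDerivAt ?_).differentiableAt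
    fin_cases i
    exacts [differentiableAt_snd.fst, differentiableAt_snd.snd]
  have hcoord {X : VField E M} (hX : DiffAt X x) :
      MDifferentiableAt 𝓘(ℂ, E) 𝓘(ℂ, E) (fun y ↦ coord x (X y)) x :=
    (mdifferentiableAt_section 𝓘(ℂ, E) X).1 hX
  have hchart : MDifferentiableAt 𝓘(ℂ, E) 𝓘(ℂ, E) (extChartAt 𝓘(ℂ, E) x) x :=
    mdifferentiableAt_extChartAt (by simp)
  refine (heval.mdifferentiableAt.comp
    (f := fun y ↦ (extChartAt 𝓘(ℂ, E) x y, coord x (Y y), coord x (Z y))) x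
    (hchart.prodMk_space ((hcoord hY).prodMk_space (hcoord hZ)))).congr_of_eventuallyEq ?_
  filter_upwards [extChartAt_source_mem_nhds (I := 𝓘(ℂ, E)) x] with y hy
  exact η.apply_eq_inChart hy _ _

lemma TwoForm.IsHolomorphic.mvfderiv_extend (hη : η.IsHolomorphic)
    (u v w : TangentSpace 𝓘(ℂ, E) x) :
    mvfderiv 𝓘(ℂ, E) (fun y ↦ η y ![FiberBundle.extend E v y, FiberBundle.extend E w y]) x u =
      fderiv ℂ (η.inChart x) (extChartAt 𝓘(ℂ, E) x x) (coord x u) ![coord x v, coord x w] := by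
  have hinChart := (hη.differentiableAt x).hasFDerivAt.continuousAlternatingMap_apply_const
    ![coord x v, coord x w]
  have hchart : MDifferentiableAt 𝓘(ℂ, E) 𝓘(ℂ, E) (extChartAt 𝓘(ℂ, E) x) x :=
    mdifferentiableAt_extChartAt (by simp)
  have heq : (fun y ↦ η y ![FiberBundle.extend E v y, FiberBundle.extend E w y]) =ᶠ[𝓝 x]
      (fun z ↦ η.inChart x z ![coord x v, coord x w]) ∘ extChartAt 𝓘(ℂ, E) x := by
    filter_upwards [extChartAt_source_mem_nhds (I := 𝓘(ℂ, E)) x] with y hy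
    rw [η.apply_eq_inChart hy, coord_extend hy, coord_extend hy, Function.comp_apply]
  have h := ((hinChart.hasMFDerivAt.comp x hchart.hasMFDerivAt).congr_of_eventuallyEq heq).mfderiv
  rw [coord_self u]
  exact congrArg (fun L : E →L[ℂ] ℂ ↦ L u) h

lemma TwoForm.IsClosed.mvfderiv_cyclic (hη : η.IsHolomorphic) (hc : η.IsClosed)
    (u v w : TangentSpace 𝓘(ℂ, E) x) :
    mvfderiv 𝓘(ℂ, E) (fun y ↦ η y ![FiberBundle.extend E v y, FiberBundle.extend E w y]) x u
    + mvfderiv 𝓘(ℂ, E) (fun y ↦ η y ![FiberBundle.extend E w y, FiberBundle.extend E u y]) x v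
    + mvfderiv 𝓘(ℂ, E) (fun y ↦ η y ![FiberBundle.extend E u y, FiberBundle.extend E v y]) x w
      = 0 := by
  have h := congr($(hc x _ (mem_extChartAt_target x)) ![coord x u, coord x v, coord x w])
  have h₁ : Fin.removeNth 1 ![coord x u, coord x v, coord x w] = ![coord x u, coord x w] := by
    ext i; fin_cases i <;> rfl
  have h₂ : Fin.removeNth 2 ![coord x u, coord x v, coord x w] = ![coord x u, coord x v] := by
    ext i; fin_cases i <;> rfl
  rw [extDeriv, ContinuousAlternatingMap.alternatizeUncurryFin_apply, Fin.sum_univ_three,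
    Fin.removeNth_zero, h₁, h₂] at h
  simp only [Fin.val_zero, Fin.val_one, Fin.val_two, pow_zero, pow_one, one_smul, neg_smul,
    even_two.neg_one_pow, ContinuousAlternatingMap.coe_zero, Pi.zero_apply, Matrix.cons_val] at h
  rw [hη.mvfderiv_extend, hη.mvfderiv_extend, hη.mvfderiv_extend,
    apply_swap (fderiv ℂ (η.inChart x) (extChartAt 𝓘(ℂ, E) x x) (coord x v))]
  exact h

/-- The extensions are constant in the preferred chart at `x`, so they commute. -/
lemma mlieBracket_extend (v w : TangentSpace 𝓘(ℂ, E) x) :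
    VectorField.mlieBracket 𝓘(ℂ, E) (FiberBundle.extend E v : VField E M)
      (FiberBundle.extend E w) x = 0 := by
  have hconst (v : TangentSpace 𝓘(ℂ, E) x) {z : E} (hz : z ∈ (extChartAt 𝓘(ℂ, E) x).target) :
      VectorField.mpullbackWithin 𝓘(ℂ, E) 𝓘(ℂ, E) (extChartAt 𝓘(ℂ, E) x).symm
        (FiberBundle.extend E v : VField E M) (Set.range 𝓘(ℂ, E)) z = coord x v := by
    have hs := (extChartAt 𝓘(ℂ, E) x).map_target hz
    have h := mfderiv_symm_coord hz (FiberBundle.extend E v _)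
    rw [coord_extend hs, ← mfderivWithin_univ, ← ModelWithCorners.range_eq_univ 𝓘(ℂ, E)] at h
    rw [VectorField.mpullbackWithin_apply]
    exact (isInvertible_mfderivWithin_extChartAt_symm hz).inverse_apply_eq.2 h.symm
  have hev (v : TangentSpace 𝓘(ℂ, E) x) :
      VectorField.mpullbackWithin 𝓘(ℂ, E) 𝓘(ℂ, E) (extChartAt 𝓘(ℂ, E) x).symm
        (FiberBundle.extend E v : VField E M) (Set.range 𝓘(ℂ, E))
        =ᶠ[𝓝[(extChartAt 𝓘(ℂ, E) x).symm ⁻¹' Set.univ ∩ Set.range 𝓘(ℂ, E)]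
          (extChartAt 𝓘(ℂ, E) x x)] fun _ ↦ coord x v :=
    Filter.eventually_of_mem (mem_nhdsWithin_of_mem_nhds (extChartAt_target_mem_nhds x))
      fun _ ↦ hconst v
  rw [← VectorField.mlieBracketWithin_univ, VectorField.mlieBracketWithin_apply,
    (hev v).lieBracketWithin_vectorField_eq (hconst v (mem_extChartAt_target x)) (hev w)
      (hconst w (mem_extChartAt_target x))]
  simp only [VectorField.lieBracketWithin, fderivWithin_fun_const, Pi.zero_apply, zero_apply,
    sub_zero]
  exact ContinuousLinearMap.map_zero _

end Charts

section CovariantDerivative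

open LinearMap (ker)

variable {E : Type*} [NormedAddCommGroup E] [NormedSpace ℂ E]
  {M : Type*} [TopologicalSpace M] [ChartedSpace E M] [IsManifold 𝓘(ℂ, E) ω M]
  {cov : CovariantDerivative 𝓘(ℂ, E) E (TangentSpace 𝓘(ℂ, E) : M → Type _)}
  {η θ : TwoForm E M} {x : M}

lemma covDeriv_swap (Y Z : VField E M) (u : TangentSpace 𝓘(ℂ, E) x) :
    covDeriv cov η Y Z x u = -covDeriv cov η Z Y x u := by
  have h : (fun y ↦ η y ![Y y, Z y]) = -fun y ↦ η y ![Z y, Y y] :=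
    funext fun y ↦ η.swap y _ _
  rw [covDeriv, covDeriv, h, mvfderiv_neg, η.swap x (cov Y x u), η.swap x (Y x), _root_.neg_apply]
  ring

lemma covDeriv_add_vector (Y Z : VField E M) (u v : TangentSpace 𝓘(ℂ, E) x) :
    covDeriv cov η Y Z x (u + v) = covDeriv cov η Y Z x u + covDeriv cov η Y Z x v := by
  simp only [covDeriv, map_add, TwoForm.apply_add_left, TwoForm.apply_add_right]
  ring

lemma covDeriv_add_form (hη : η.IsHolomorphic) (hθ : θ.IsHolomorphic) {Y Z : VField E M}
    (hY : DiffAt Y x) (hZ : DiffAt Z x) (u : TangentSpace 𝓘(ℂ, E) x) :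
    covDeriv cov (η + θ) Y Z x u = covDeriv cov η Y Z x u + covDeriv cov θ Y Z x u := by
  have h : (fun y ↦ (η + θ) y ![Y y, Z y]) =
      (fun y ↦ η y ![Y y, Z y]) + fun y ↦ θ y ![Y y, Z y] := rfl
  rw [covDeriv, h, mvfderiv_add (hη.mdifferentiableAt_apply hY hZ)
    (hθ.mdifferentiableAt_apply hY hZ), _root_.add_apply]
  simp only [covDeriv, Pi.add_apply, ContinuousAlternatingMap.add_apply]
  ring

lemma covDeriv_smul_form (c : ℂ) (hη : η.IsHolomorphic) {Y Z : VField E M} (hY : DiffAt Y x)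
    (hZ : DiffAt Z x) (u : TangentSpace 𝓘(ℂ, E) x) :
    covDeriv cov (c • η) Y Z x u = c * covDeriv cov η Y Z x u := by
  have h : (fun y ↦ (c • η) y ![Y y, Z y]) = (fun _ ↦ c) * fun y ↦ η y ![Y y, Z y] := rfl
  rw [covDeriv, h, mvfderiv_mul mdifferentiableAt_const (hη.mdifferentiableAt_apply hY hZ)]
  simp only [covDeriv, Pi.smul_apply, ContinuousAlternatingMap.smul_apply, _root_.add_apply,
    _root_.smul_apply, smul_eq_mul, mvfderiv_const, _root_.zero_apply]
  ring

lemma covDeriv_smul_add_smul_add_smul {η₁ η₂ η₃ : TwoForm E M} (h₁ : η₁.IsHolomorphic)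
    (h₂ : η₂.IsHolomorphic) (h₃ : η₃.IsHolomorphic) (a b c : ℂ) {Y Z : VField E M}
    (hY : DiffAt Y x) (hZ : DiffAt Z x) (u : TangentSpace 𝓘(ℂ, E) x) :
    covDeriv cov (a • η₁ + b • η₂ + c • η₃) Y Z x u =
      a * covDeriv cov η₁ Y Z x u + b * covDeriv cov η₂ Y Z x u + c * covDeriv cov η₃ Y Z x u := by
  rw [covDeriv_add_form ((h₁.const_smul a).add (h₂.const_smul b)) (h₃.const_smul c) hY hZ,
    covDeriv_add_form (h₁.const_smul a) (h₂.const_smul b) hY hZ, covDeriv_smul_form a h₁ hY hZ,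
    covDeriv_smul_form b h₂ hY hZ, covDeriv_smul_form c h₃ hY hZ]

lemma tensorialAt_covDeriv_left (hη : η.IsHolomorphic) {Z : VField E M} (hZ : DiffAt Z x)
    (u : TangentSpace 𝓘(ℂ, E) x) :
    TensorialAt 𝓘(ℂ, E) E (fun Y : VField E M ↦ covDeriv cov η Y Z x u) x where
  smul {f Y} hf hY := by
    have h : (fun y ↦ η y ![(f • Y) y, Z y]) = f * fun y ↦ η y ![Y y, Z y] :=
      funext fun y ↦ η.apply_smul_left y _ _ _
    simp only [covDeriv]
    rw [h, mvfderiv_mul hf (hη.mdifferentiableAt_apply hY hZ),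
      cov.isCovariantDerivativeOn.leibniz hY hf]
    simp only [_root_.add_apply, _root_.smul_apply, ContinuousLinearMap.smulRight_apply,
      TwoForm.apply_add_left, TwoForm.apply_smul_left, Pi.smul_apply', smul_eq_mul]
    ring
  add {Y Y'} hY hY' := by
    have h : (fun y ↦ η y ![(Y + Y') y, Z y]) =
        (fun y ↦ η y ![Y y, Z y]) + fun y ↦ η y ![Y' y, Z y] :=
      funext fun y ↦ η.apply_add_left y _ _ _
    simp only [covDeriv]
    rw [h, mvfderiv_add (hη.mdifferentiableAt_apply hY hZ) (hη.mdifferentiableAt_apply hY' hZ),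
      cov.isCovariantDerivativeOn.add hY hY']
    simp only [_root_.add_apply, TwoForm.apply_add_left, Pi.add_apply]
    ring

lemma tensorialAt_covDeriv_right (hη : η.IsHolomorphic) {Y : VField E M} (hY : DiffAt Y x)
    (u : TangentSpace 𝓘(ℂ, E) x) :
    TensorialAt 𝓘(ℂ, E) E (fun Z : VField E M ↦ covDeriv cov η Y Z x u) x where
  smul {f Z} hf hZ := by
    rw [covDeriv_swap, (tensorialAt_covDeriv_left hη hY u).smul hf hZ, covDeriv_swap Y, smul_neg]
  add {Z Z'} hZ hZ' := by
    rw [covDeriv_swap, (tensorialAt_covDeriv_left hη hY u).add hZ hZ', covDeriv_swap Y,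
      covDeriv_swap Y, neg_add]

lemma covDeriv_eq_zero_of_mem_null (hpres : Preserves cov η.null) {U : Set M} (hU : IsOpen U)
    (hxU : x ∈ U) {Y : VField E M} (hY : HolomorphicOn Y U) (hYη : ∀ y ∈ U, Y y ∈ η.null y)
    (Z : VField E M) (u : TangentSpace 𝓘(ℂ, E) x) : covDeriv cov η Y Z x u = 0 := by
  have hYZ : (fun y ↦ η y ![Y y, Z y]) =ᶠ[𝓝 x] fun _ ↦ 0 := by
    filter_upwards [hU.mem_nhds hxU] with y hy using hYη y hy _
  have hderiv : mvfderiv 𝓘(ℂ, E) (fun y ↦ η y ![Y y, Z y]) x = 0 :=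
    ((hasMFDerivAt_const (0 : ℂ) x).congr_of_eventuallyEq hYZ).mfderiv
  have hcovY : η x ![cov Y x u, Z x] = 0 := hpres U hU Y hY hYη x hxU u _
  have hcovZ : η x ![Y x, cov Z x u] = 0 := hYη x hxU _
  rw [covDeriv, hderiv, hcovY, hcovZ, _root_.zero_apply, sub_zero, sub_zero]

lemma diffAt_extend (v : TangentSpace 𝓘(ℂ, E) x) : DiffAt (FiberBundle.extend E v : VField E M) x :=
  FiberBundle.mdifferentiableAt_extend 𝓘(ℂ, E) E v

lemma IsHolomorphicSubbundle.exists_section {n : ℕ} {D : Distribution E M}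
    (hD : IsHolomorphicSubbundle n D) {v : TangentSpace 𝓘(ℂ, E) x} (hv : v ∈ D x) :
    ∃ U : Set M, IsOpen U ∧ x ∈ U ∧ ∃ X : VField E M, HolomorphicOn X U ∧ (∀ y ∈ U, X y ∈ D y) ∧
      X x = v := by
  obtain ⟨U, hU, hxU, s, hs, hsU⟩ := hD x
  rw [← (hsU x hxU).2] at hv
  obtain ⟨c, hc⟩ := (Submodule.mem_span_range_iff_exists_fun ℂ).1 hv
  refine ⟨U, hU, hxU, fun y ↦ ∑ i, c i • s i y, ?_, fun y hy ↦ ?_, hc⟩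
  · exact ContMDiffOn.sum_section fun i _ ↦ (contMDiffOn_const (c := c i)).smul_section (hs i)
  · rw [← (hsU y hy).2]
    exact Submodule.sum_mem _ fun i _ ↦ Submodule.smul_mem _ _ (Submodule.subset_span ⟨i, rfl⟩)

variable [FiniteDimensional ℂ E]

variable (cov) in
/-- The covariant derivative of a holomorphic 2-form along a tangent vector, as a bilinear form on
the tangent space. -/
def covTensor (hη : η.IsHolomorphic) (u : TangentSpace 𝓘(ℂ, E) x) :
    LinearMap.BilinForm ℂ (TangentSpace 𝓘(ℂ, E) x) :=
  (TensorialAt.mkHom₂ (fun Y Z : VField E M ↦ covDeriv cov η Y Z x u) x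
    (fun _ hZ ↦ tensorialAt_covDeriv_left hη hZ u)
    fun _ hY ↦ tensorialAt_covDeriv_right hη hY u).toLinearMap₁₂

lemma covTensor_apply (hη : η.IsHolomorphic) {Y Z : VField E M} (hY : DiffAt Y x)
    (hZ : DiffAt Z x) (u : TangentSpace 𝓘(ℂ, E) x) :
    covTensor cov hη u (Y x) (Z x) = covDeriv cov η Y Z x u :=
  TensorialAt.mkHom₂_apply (fun _ hZ ↦ tensorialAt_covDeriv_left hη hZ u)
    (fun _ hY ↦ tensorialAt_covDeriv_right hη hY u) hY hZ

lemma covTensor_eq_extend (hη : η.IsHolomorphic) (u v w : TangentSpace 𝓘(ℂ, E) x) :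
    covTensor cov hη u v w =
      covDeriv cov η (FiberBundle.extend E v) (FiberBundle.extend E w) x u := rfl

lemma isRefl_covTensor (hη : η.IsHolomorphic) (u : TangentSpace 𝓘(ℂ, E) x) :
    (covTensor cov hη u).IsRefl := fun v w h ↦ by
  rw [covTensor_eq_extend] at h ⊢
  rw [covDeriv_swap, h, neg_zero]

lemma covTensor_add (hη : η.IsHolomorphic) (u v : TangentSpace 𝓘(ℂ, E) x) :
    covTensor cov hη (u + v) = covTensor cov hη u + covTensor cov hη v :=
  LinearMap.ext₂ fun _ _ ↦ covDeriv_add_vector _ _ u v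

lemma covTensor_eq_smul_add_smul_add_smul {η₁ η₂ η₃ : TwoForm E M} (hη : η.IsHolomorphic)
    (h₁ : η₁.IsHolomorphic) (h₂ : η₂.IsHolomorphic) (h₃ : η₃.IsHolomorphic) {a b c : ℂ}
    (h : η = a • η₁ + b • η₂ + c • η₃) (u : TangentSpace 𝓘(ℂ, E) x) :
    covTensor cov hη u =
      a • covTensor cov h₁ u + b • covTensor cov h₂ u + c • covTensor cov h₃ u := by
  subst h
  exact LinearMap.ext₂ fun v w ↦
    covDeriv_smul_add_smul_add_smul h₁ h₂ h₃ a b c (diffAt_extend v) (diffAt_extend w) u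

lemma covTensor_cyclic [CompleteSpace E] (hcov : cov.torsion = 0) (hη : η.IsHolomorphic)
    (hc : η.IsClosed) (u v w : TangentSpace 𝓘(ℂ, E) x) :
    covTensor cov hη u v w + covTensor cov hη v w u + covTensor cov hη w u v = 0 := by
  have hsymm (v w : TangentSpace 𝓘(ℂ, E) x) :
      cov (FiberBundle.extend E w) x v = cov (FiberBundle.extend E v) x w := by
    have h := cov.torsion_eq_zero_iff.1 hcov (diffAt_extend v) (diffAt_extend w)
    rw [mlieBracket_extend, FiberBundle.extend_apply_self, FiberBundle.extend_apply_self] at h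
    exact sub_eq_zero.1 h
  simp only [covTensor_eq_extend, covDeriv, FiberBundle.extend_apply_self]
  rw [hsymm v u, hsymm w v, hsymm u w, η.swap x v, η.swap x w, η.swap x u]
  linear_combination hc.mvfderiv_cyclic hη u v w

lemma null_le_ker_covTensor {n : ℕ} (hη : η.IsHolomorphic)
    (hnull : IsHolomorphicSubbundle n η.null) (hpres : Preserves cov η.null)
    (u : TangentSpace 𝓘(ℂ, E) x) : η.null x ≤ ker (covTensor cov hη u) := fun v hv ↦ by
  obtain ⟨U, hU, hxU, Y, hY, hYη, rfl⟩ := hnull.exists_section hv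
  refine LinearMap.mem_ker.2 (LinearMap.ext fun w ↦ ?_)
  have h := covTensor_apply (cov := cov) hη (hY.holomorphicAt hU hxU).diffAt (diffAt_extend w) u
  rw [FiberBundle.extend_apply_self] at h
  rw [h, covDeriv_eq_zero_of_mem_null hpres hU hxU hY hYη, LinearMap.zero_apply]

end CovariantDerivative

section Parallel

open LinearMap (ker)

variable {E : Type*} [NormedAddCommGroup E] [NormedSpace ℂ E] [FiniteDimensional ℂ E]
  [CompleteSpace E]
  {M : Type*} [TopologicalSpace M] [ChartedSpace E M] [IsManifold 𝓘(ℂ, E) ω M]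
  {cov : CovariantDerivative 𝓘(ℂ, E) E (TangentSpace 𝓘(ℂ, E) : M → Type _)}
  {n : ℕ} {S : CP1 → Distribution E M} {Ω : Submodule ℂ (TwoForm E M)} {x : M} {r t t' : CP1}

namespace GeneratesWeb

variable (hΩ : GeneratesWeb Ω S)
include hΩ

variable (hS : IsSL2Web n S) (hcov : IsChernConnection S cov)
include hS hcov

lemma le_ker_covTensor_form (t : CP1) (u : TangentSpace 𝓘(ℂ, E) x) :
    S t x ≤ ker (covTensor cov (hΩ.isHolomorphic_form t) u) := by
  have hnull := hΩ.null_form t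
  rw [← hnull]
  exact null_le_ker_covTensor _ (hnull ▸ hS.subbundle t) (hnull ▸ hcov.preserves t) u

lemma codisjoint_ker_covTensor_form (h : t ≠ t') (u : TangentSpace 𝓘(ℂ, E) x) :
    Codisjoint (ker (covTensor cov (hΩ.isHolomorphic_form t) u))
      (ker (covTensor cov (hΩ.isHolomorphic_form t') u)) :=
  (hS.isCompl h x).codisjoint.mono (hΩ.le_ker_covTensor_form hS hcov t u)
    (hΩ.le_ker_covTensor_form hS hcov t' u)

lemma covTensor_form_self {u : TangentSpace 𝓘(ℂ, E) x} (hu : u ∈ S t x) :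
    covTensor cov (hΩ.isHolomorphic_form t) u = 0 := by
  refine LinearMap.ext₂ fun v w ↦ ?_
  have h := covTensor_cyclic hcov.torsion_free (hΩ.isHolomorphic_form t)
    (hΩ.closed _ (hΩ.form_mem t)) u v w
  rwa [apply_eq_zero_of_mem_ker_right (isRefl_covTensor _ v) w
      (hΩ.le_ker_covTensor_form hS hcov t v hu),
    LinearMap.mem_ker.1 (hΩ.le_ker_covTensor_form hS hcov t w hu), LinearMap.zero_apply,
    add_zero, add_zero] at h

lemma covTensor_form_of_mem (hrt : r ≠ t) {u : TangentSpace 𝓘(ℂ, E) x} (hu : u ∈ S r x) :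
    covTensor cov (hΩ.isHolomorphic_form t) u = 0 := by
  obtain ⟨p, hp⟩ := (Set.toFinite {r, t}).exists_notMem
  obtain ⟨q, hq⟩ := (Set.toFinite {r, t, p}).exists_notMem
  simp only [Set.mem_insert_iff, Set.mem_singleton_iff, not_or] at hp hq
  obtain ⟨hpr, hpt⟩ := hp
  obtain ⟨hqr, hqt, hqp⟩ := hq
  obtain ⟨b, a, c, h⟩ := hΩ.exists_eq_smul_form hS hrt.symm (Ne.symm hqt) (Ne.symm hqr)
    (hΩ.form_mem p)
  have hcovp := covTensor_eq_smul_add_smul_add_smul (cov := cov) (hΩ.isHolomorphic_form p)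
    (hΩ.isHolomorphic_form t) (hΩ.isHolomorphic_form r) (hΩ.isHolomorphic_form q) h u
  rw [hΩ.covTensor_form_self hS hcov hu, smul_zero, add_zero] at hcovp
  exact eq_zero_of_eq_smul_add_smul (isRefl_covTensor _ u) (isRefl_covTensor _ u)
    (hΩ.codisjoint_ker_covTensor_form hS hcov hpt u)
    (hΩ.codisjoint_ker_covTensor_form hS hcov (Ne.symm hqt) u) hcovp
    (hΩ.coeff_ne_zero hS hpr (Ne.symm hqp) h)

lemma covTensor_form (t : CP1) (u : TangentSpace 𝓘(ℂ, E) x) :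
    covTensor cov (hΩ.isHolomorphic_form t) u = 0 := by
  obtain ⟨r, hrt⟩ := exists_ne t
  obtain ⟨v, hv, w, hw, rfl⟩ := Submodule.mem_sup.1
    ((hS.isCompl hrt x).sup_eq_top ▸ Submodule.mem_top (x := u))
  rw [covTensor_add, hΩ.covTensor_form_of_mem hS hcov hrt hv, hΩ.covTensor_form_self hS hcov hw,
    add_zero]

lemma isParallel {η : TwoForm E M} (hη : η ∈ Ω) : IsParallel cov η := by
  intro U hU Y Z hY hZ x hx u
  obtain ⟨p, q, hpq⟩ := exists_pair_ne CP1
  obtain ⟨r, hr⟩ := (Set.toFinite {p, q}).exists_notMem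
  simp only [Set.mem_insert_iff, Set.mem_singleton_iff, not_or] at hr
  obtain ⟨a, b, c, h⟩ := hΩ.exists_eq_smul_form hS hpq (Ne.symm hr.1) (Ne.symm hr.2) hη
  rw [← covTensor_apply (hΩ.holomorphic η hη) (hY.holomorphicAt hU hx).diffAt
    (hZ.holomorphicAt hU hx).diffAt u, covTensor_eq_smul_add_smul_add_smul _
    (hΩ.isHolomorphic_form p) (hΩ.isHolomorphic_form q) (hΩ.isHolomorphic_form r) h u]
  simp only [hΩ.covTensor_form hS hcov, smul_zero, add_zero, LinearMap.zero_apply]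

end GeneratesWeb

end Parallel

end SL2Web

end

theorem mainTheorem6 {E : Type*} [NormedAddCommGroup E] [NormedSpace ℂ E] [FiniteDimensional ℂ E]
    [CompleteSpace E] {M : Type*} [TopologicalSpace M] [ChartedSpace E M]
    [IsManifold 𝓘(ℂ, E) ω M] (n : ℕ)
    (S : SL2Web.CP1 → SL2Web.Distribution E M) (hS : SL2Web.IsSL2Web n S)
    (Ω : Submodule ℂ (SL2Web.TwoForm E M)) (hΩ : SL2Web.GeneratesWeb Ω S) :
    (∃ cov : CovariantDerivative 𝓘(ℂ, E) E (TangentSpace 𝓘(ℂ, E) : M → Type _),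
      SL2Web.IsChernConnection S cov) ∧
    ∀ cov : CovariantDerivative 𝓘(ℂ, E) E (TangentSpace 𝓘(ℂ, E) : M → Type _),
      SL2Web.IsChernConnection S cov → ∀ η ∈ Ω, SL2Web.IsParallel cov η := by
  exact ⟨hΩ.exists_isChernConnection hS, fun cov hcov η hη ↦ hΩ.isParallel hS hcov hη⟩
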